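/- Let $R$ be a noether algebra, that is, a ring (not necessarily commutative) that is finitely generated as a module over its centre, the centre being a noetherian ring. Modules are left modules, and $\operatorname{gldim}$ denotes global dimension (for the rings below, which are noetherian on both sides, the left and right global dimensions agree; the zero ring has global dimension $0$). Let $M$ and $X$ be finitely generated $R$-modules and let $d$ be a positive integer. We use the following notions. - A finitely generated module $M$ is a *generator* if $R$ is a direct summand of $M^n$ for some $n$. - It is *$d$-torsionfree* if $\operatorname{Ext}^i_{R^{\mathrm{op}}}(\operatorname{Tr} M,R)=0$ for $1\le i\le d$, where $\operatorname{Tr}M$ is the Auslander transpose of $M$, i.e. the cokernel of $\operatorname{Hom}_R(P_0,R)\to\operatorname{Hom}_R(P_1,R)$ for a presentation $P_1\to P_0\to M\to 0$ by finitely generated projective modules; for $d=0$ the condition is empty. - It *gives a noncommutative resolution (NCR)* of $R$ if it is faithful and $\operatorname{gldim}\operatorname{End}_R(M)<\infty$. - $\operatorname{grade}_R X=\inf\{n\ge 0\mid \operatorname{Ext}^n_R(X,R)\ne 0\}$, which is $\infty$ if there is no such $n$. - A $c$-th syzygy $\Omega^cX$ is any module that fits into an exact sequence $0\to\Omega^cX\to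 P_{c-1}\to\cdots\to P_0\to X\to 0$ with all $P_i$ finitely generated projective; $\Omega^0X=X$. Suppose that $M$ is a $d$-torsionfree generator giving an NCR of $R$, and that $\operatorname{gldim}\operatorname{End}_R(X)<\infty$. Then for every integer $c$ with $0\le c<\min\{d,\operatorname{grade}_RX\}$ and every choice of $\Omega^cX$: 1. the $R$-module $M\oplus\Omega^cX$ is a $c$-torsionfree generator; 2. $\operatorname{gldim}\operatorname{End}_R(M\oplus\Omega^cX)\le 2\operatorname{gldim}\operatorname{End}_R(M)+\operatorname{gldim}\operatorname{End}_R(X)+1.$ In particular, $M\oplus\Omega^cX$ gives an NCR of $R$. -/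

import Mathlib

open CategoryTheory CategoryTheory.Abelian

universe u

noncomputable section

/-- A noether algebra: a (not necessarily commutative) ring that is finitely generated as a module
over its centre, the centre being a noetherian ring. -/
structure IsNoetherAlgebra (R : Type u) [Ring R] : Prop where
  noetherian_center : IsNoetherianRing (Subring.center R)
  finite_over_center : Module.Finite (Subring.center R) R

/-- The global dimension of a ring: the supremum of the projective dimensions of its left modules.
It takes values in `ℕ∞`; zero modules contribute `0`, so that the zero ring has global
dimension `0`. -/
def gldim (A : Type u) [Ring A] : ℕ∞ :=
  ⨆ N : ModuleCat.{u} A, (projectiveDimension N).unbotD 0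

/-- The endomorphism ring `End_R(M)` of a left module `M`, with the usual convention for left
modules that endomorphisms are written on the right. With this convention `Hom_R(M, N)` is a *left*
`End_R(M)`-module by precomposition, and `Hom_R(M, -)` identifies `add M` with the finitely
generated projective left `End_R(M)`-modules. (With the opposite convention one gets the opposite
ring; over a noether algebra it is noetherian on both sides for finitely generated `M`, and the
left and right global dimensions of a two-sided noetherian ring are equal.) -/
abbrev EndRing (R M : Type u) [Ring R] [AddCommGroup M] [Module R M] : Type u :=
  (Module.End R M)ᵐᵒᵖ

/-- A finitely generated faithful module `M` gives a noncommutative resolution of `R` if the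
global dimension of `End_R(M)` is finite. -/
structure GivesNCR (R M : Type u) [Ring R] [AddCommGroup M] [Module R M] : Prop where
  finite : Module.Finite R M
  faithful : FaithfulSMul R M
  gldim_ne_top : gldim (EndRing R M) ≠ ⊤

/-- `M` is a generator: `R` belongs to `add M`, that is, the left module `R` is a direct summand of
a finite direct sum of copies of `M`. -/
def IsGenerator (R M : Type u) [Ring R] [AddCommGroup M] [Module R M] : Prop :=
  ∃ (n : ℕ) (i : R →ₗ[R] (Fin n → M)) (p : (Fin n → M) →ₗ[R] R), p ∘ₗ i = LinearMap.id

/-- The grade of a module: `inf {n | Ext^n_R(X, R) ≠ 0}`, which is `⊤` if all of these groups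
vanish. -/
def moduleGrade (R X : Type u) [Ring R] [AddCommGroup X] [Module R X] : ℕ∞ :=
  ⨅ (n : ℕ) (_ : Nontrivial (Ext (ModuleCat.of R X) (ModuleCat.of R R) n)), (n : ℕ∞)

/-- The map `f^* : Hom_R(Q, R) → Hom_R(P, R)` of right `R`-modules induced by a map `f : P → Q` of
left `R`-modules. Right `R`-modules are modules over `Rᵐᵒᵖ`, and `R` acts on the right of
`Hom_R(P, R)` through the right action on the target. -/
def dualMap {R P Q : Type u} [Ring R] [AddCommGroup P] [Module R P] [AddCommGroup Q] [Module R Q]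
    (f : P →ₗ[R] Q) : (Q →ₗ[R] R) →ₗ[Rᵐᵒᵖ] (P →ₗ[R] R) where
  toFun φ := φ ∘ₗ f
  map_add' _ _ := rfl
  map_smul' _ _ := rfl

/-- The cokernel of `f^*`, a right `R`-module. If `P →f Q → M → 0` is a presentation of `M` by
finitely generated projective modules, this is the Auslander transpose `Tr M`. -/
abbrev TransposeOf {R P Q : Type u} [Ring R] [AddCommGroup P] [Module R P] [AddCommGroup Q]
    [Module R Q] (f : P →ₗ[R] Q) : Type u :=
  (P →ₗ[R] R) ⧸ LinearMap.range (dualMap f)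

/-- `M` is `d`-torsionfree: `Ext^i(Tr M, R) = 0` for `1 ≤ i ≤ d`, where `Tr M` is computed from
a presentation `P → Q → M → 0` by finitely generated projective modules. As `Tr M` is unique up to
projective direct summands, the choice of the presentation does not matter. -/
def IsTorsionfree (d : ℕ) (R M : Type u) [Ring R] [AddCommGroup M] [Module R M] : Prop :=
  ∃ (P Q : Type u) (_ : AddCommGroup P) (_ : Module R P) (_ : AddCommGroup Q) (_ : Module R Q)
    (f : P →ₗ[R] Q) (g : Q →ₗ[R] M),
    Module.Finite R P ∧ Module.Projective R P ∧ Module.Finite R Q ∧ Module.Projective R Q ∧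
    Function.Exact f g ∧ Function.Surjective g ∧
    ∀ i : ℕ, 1 ≤ i → i ≤ d →
      Subsingleton (Ext (ModuleCat.of Rᵐᵒᵖ (TransposeOf f)) (ModuleCat.of Rᵐᵒᵖ R) i)

/-- `IsSyzygy R c X K`: the module `K` is a `c`-th syzygy `Ω^c X` of `X`, that is, there is an exact
sequence `0 → K → P_{c-1} → ⋯ → P_0 → X → 0` with all `P_i` finitely generated projective.
For `c = 0` this says that `K` is isomorphic to `X`. -/
def IsSyzygy (R : Type u) [Ring R] :
    (c : ℕ) → (X K : Type u) → [AddCommGroup X] → [Module R X] → [AddCommGroup K] →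
      [Module R K] → Prop
  | 0, X, K, _, _, _, _ => Nonempty (K ≃ₗ[R] X)
  | c + 1, X, K, _, _, _, _ =>
    ∃ (P : Type u) (_ : AddCommGroup P) (_ : Module R P) (p : P →ₗ[R] X),
      Module.Finite R P ∧ Module.Projective R P ∧ Function.Surjective p ∧
      IsSyzygy R c (LinearMap.ker p) K

end

/-!
Write `K = Ω^c X`, `W = M ⊕ K`, `A = End(M)`, `B = End(W)`, and let `e ∈ B` be the idempotent
projecting to `M`, so that `eBe = A`.

*Torsionfreeness.* By Auslander and Bridger, over a noether algebra the `d`-torsionfree modules are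
those with an exact sequence `0 → M → F₀ → ⋯ → F_{d-1}` of finitely generated projectives that
stays exact under `Hom(-, R)` (`extVanishes_transpose_iff`). As `Ext^i(X, R) = 0` for `i ≤ c`, the
syzygy sequence of `K` is such a sequence of length `c`, and direct sums of such sequences are again
of this kind. The same sequences give `Ext^i(X, M) = 0` for `i ≤ c` and `Ext^i(X, K) = 0` for `i < c`.

*The ring `B/BeB`.* The class `δ ∈ Ext^c(X, K)` of the syzygy sequence induces, for every `L`, a
surjection `Hom(K, L) → Ext^c(X, L)` whose kernel consists of maps factoring through projectives,
and an isomorphism `End(X) → Ext^c(X, K)` (`IsSyzygy.exists_class`). Sending `b ∈ B` to the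
endomorphism `g` of `X` with `g δ = δ b` is a surjective ring homomorphism `B → End(X)` with kernel
`BeB`, the ideal of the maps that factor through sums of copies of `M`.

*The bound.* Let `n` and `m` be the global dimensions of `A` and `End(X)`. Approximating by sums of
copies of `M` produces kernels `L` with `Ext^c(X, L) = 0`; all maps `K → L` then factor through
projectives, and a resolution of `Hom(M, W)` over `A` lifts to one of the `B`-module `BeB`, which
therefore has projective dimension at most `n` (`pd_cornerSpan_homModule_le`). Hence `B/BeB` has
projective dimension at most `n + 1` over `B`, and by change of rings (`pd_restrictScalars`) every
`B`-module killed by `e` has projective dimension at most `n + 1 + m`. Finally, for any `N`, a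
resolution of `eN` over `A` lifts to a complex of direct sums of copies of `Be` whose homology is
killed by `e`, which costs another `n` (`pd_le_of_corner`).
-/

noncomputable section

/-! ### Projective dimension of modules -/

section ProjectiveDimension

variable {S : Type u} [Ring S] {N₁ N₂ N₃ : Type u} [AddCommGroup N₁] [Module S N₁]
  [AddCommGroup N₂] [Module S N₂] [AddCommGroup N₃] [Module S N₃]

theorem shortExact_moduleCat {f : N₁ →ₗ[S] N₂} {g : N₂ →ₗ[S] N₃} (hf : Function.Injective f)
    (hfg : Function.Exact f g) (hg : Function.Surjective g) :
    (ShortComplex.mk (ModuleCat.ofHom f) (ModuleCat.ofHom g)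
      (by rw [← ModuleCat.ofHom_comp, hfg.linearMap_comp_eq_zero]; rfl)).ShortExact where
  exact := (ShortComplex.ShortExact.moduleCat_exact_iff_function_exact _).2 hfg
  mono_f := (ModuleCat.mono_iff_injective _).2 hf
  epi_g := (ModuleCat.epi_iff_surjective _).2 hg

/-- The projective dimension of the module `N` is at most `k`. -/
abbrev PdLE (S : Type u) [Ring S] (N : Type u) [AddCommGroup N] [Module S N] (k : ℕ) : Prop :=
  HasProjectiveDimensionLE (ModuleCat.of S N) k

theorem PdLE.mono {k l : ℕ} (h : PdLE S N₁ k) (hkl : k ≤ l) : PdLE S N₁ l :=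
  @hasProjectiveDimensionLT_of_ge _ _ _ _ _ _ (by omega) h

theorem PdLE.of_equiv {k : ℕ} (h : PdLE S N₁ k) (e : N₁ ≃ₗ[S] N₂) : PdLE S N₂ k :=
  @hasProjectiveDimensionLT_of_iso _ _ _ _ _ e.toModuleIso _ h

theorem pdLE_zero_iff : PdLE S N₁ 0 ↔ Module.Projective S N₁ := by
  rw [PdLE, ← projective_iff_hasProjectiveDimensionLE_zero, IsProjective.iff_projective]

theorem PdLE.of_projective [h : Module.Projective S N₁] (k : ℕ) : PdLE S N₁ k :=
  (pdLE_zero_iff.2 h).mono (Nat.zero_le k)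

section

variable {f : N₁ →ₗ[S] N₂} {g : N₂ →ₗ[S] N₃} (hf : Function.Injective f)
    (hfg : Function.Exact f g) (hg : Function.Surjective g) {k : ℕ}
include hf hfg hg

theorem PdLE.middle (h₁ : PdLE S N₁ k) (h₃ : PdLE S N₃ k) : PdLE S N₂ k :=
  (shortExact_moduleCat hf hfg hg).hasProjectiveDimensionLT_X₂ _ h₁ h₃

theorem PdLE.right (h₁ : PdLE S N₁ k) (h₂ : PdLE S N₂ (k + 1)) : PdLE S N₃ (k + 1) :=
  (shortExact_moduleCat hf hfg hg).hasProjectiveDimensionLT_X₃ _ h₁ h₂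

theorem PdLE.left (h₂ : PdLE S N₂ k) (h₃ : PdLE S N₃ (k + 1)) : PdLE S N₁ k :=
  (shortExact_moduleCat hf hfg hg).hasProjectiveDimensionLT_X₁ _ h₂ h₃

end

theorem exists_free_surjective (S : Type u) [Ring S] (N : Type u) [AddCommGroup N] [Module S N] :
    ∃ p : (N →₀ S) →ₗ[S] N, Function.Surjective p :=
  ⟨Finsupp.linearCombination S id, Finsupp.linearCombination_id_surjective S N⟩

theorem projective_finsupp (ι : Type u) (S : Type u) [Ring S] (N : Type u) [AddCommGroup N]
    [Module S N] [Module.Projective S N] : Module.Projective S (ι →₀ N) := by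
  classical
  exact Module.Projective.of_equiv' (finsuppLequivDFinsupp (M := N) (ι := ι) S).symm

/-- The projective dimension does not grow under direct sums. -/
theorem PdLE.finsupp (ι : Type u) {k : ℕ} :
    ∀ {N : Type u} [AddCommGroup N] [Module S N], PdLE S N k → PdLE S (ι →₀ N) k := by
  induction k with
  | zero =>
    intro N _ _ h
    have := pdLE_zero_iff.1 h
    have := projective_finsupp ι S N
    exact PdLE.of_projective 0
  | succ k ih =>
    intro N _ _ h
    obtain ⟨p, hp⟩ := exists_free_surjective S N
    have h₁ : PdLE S (LinearMap.ker p) k :=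
      PdLE.left (Submodule.subtype_injective _) (LinearMap.exact_subtype_ker_map p) hp
        (PdLE.of_projective k) h
    have := projective_finsupp ι S (N →₀ S)
    refine PdLE.right (N₂ := ι →₀ N →₀ S)
      (f := Finsupp.mapRange.linearMap (α := ι) (LinearMap.ker p).subtype)
      (g := Finsupp.mapRange.linearMap (α := ι) p) ?_ ?_ ?_ (ih h₁) (PdLE.of_projective _)
    · exact Finsupp.mapRange_injective _ rfl (Submodule.subtype_injective _)
    · intro x
      refine ⟨fun hx => ?_, ?_⟩
      · have hx' : ∀ i, p (x i) = 0 := fun i => DFunLike.congr_fun hx i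
        classical
        refine ⟨Finsupp.onFinset x.support (fun i => ⟨x i, hx' i⟩) ?_, ?_⟩
        · intro i hi
          simpa [Subtype.ext_iff] using hi
        · ext i
          simp
      · rintro ⟨y, rfl⟩
        ext i
        simp
    · exact Finsupp.mapRange_surjective _ (map_zero p) hp

end ProjectiveDimension

/-! ### Global dimension -/

theorem gldim_le_iff {S : Type u} [Ring S] {k : ℕ} :
    gldim S ≤ k ↔ ∀ (N : Type u) [AddCommGroup N] [Module S N], PdLE S N k := by
  have key : ∀ x : WithBot ℕ∞, x.unbotD 0 ≤ (k : ℕ∞) ↔ x ≤ (k : WithBot ℕ∞) := by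
    intro x
    induction x with
    | bot => simp
    | coe x => exact (WithBot.coe_le_coe (a := x) (b := (k : ℕ∞))).symm
  simp only [gldim, iSup_le_iff, key, projectiveDimension_le_iff]
  exact ⟨fun h N _ _ => h (ModuleCat.of S N), fun h N => h N⟩

/-! ### Change of rings -/

/-- Change of rings: along `ρ : S → T`, a `T`-module has projective dimension over `S` at most
its projective dimension over `T` plus the projective dimension of `T` over `S`. -/
theorem pd_restrictScalars {S T : Type u} [Ring S] [Ring T] (ρ : S →+* T) {s : ℕ}
    (hT : HasProjectiveDimensionLE ((ModuleCat.restrictScalars ρ).obj (ModuleCat.of T T)) s)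
    {k : ℕ} : ∀ N : ModuleCat.{u} T, HasProjectiveDimensionLE N k →
      HasProjectiveDimensionLE ((ModuleCat.restrictScalars ρ).obj N) (s + k) := by
  have hfree : ∀ ι : Type u, HasProjectiveDimensionLE
      ((ModuleCat.restrictScalars ρ).obj (ModuleCat.of T (ι →₀ T))) s := by
    intro ι
    have h := PdLE.finsupp (S := S) ι
      (N := (ModuleCat.restrictScalars ρ).obj (ModuleCat.of T T)) hT
    refine PdLE.of_equiv (N₂ := (ModuleCat.restrictScalars ρ).obj (ModuleCat.of T (ι →₀ T))) h
      { AddEquiv.refl (ι →₀ T) with map_smul' := fun r x => ?_ }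
    exact Finsupp.ext fun i => rfl
  induction k with
  | zero =>
    intro N hN
    have hN' : Module.Projective T N := pdLE_zero_iff.1 hN
    obtain ⟨p, hp⟩ := exists_free_surjective T N
    obtain ⟨q, hq⟩ := Module.projective_lifting_property p LinearMap.id hp
    have r : Retract N (ModuleCat.of T (N →₀ T)) :=
      { i := ModuleCat.ofHom q
        r := ModuleCat.ofHom p
        retract := by rw [← ModuleCat.ofHom_comp, hq]; rfl }
    have := hfree N
    exact (r.map (ModuleCat.restrictScalars ρ)).hasProjectiveDimensionLT _
  | succ k ih =>
    intro N hN
    obtain ⟨p, hp⟩ := exists_free_surjective T N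
    have h₁ : PdLE T (LinearMap.ker p) k :=
      PdLE.left (Submodule.subtype_injective _) (LinearMap.exact_subtype_ker_map p) hp
        (PdLE.of_projective k) hN
    have h₁' := ih _ h₁
    let f := ((ModuleCat.restrictScalars ρ).map (ModuleCat.ofHom (X := LinearMap.ker p)
      (Y := N →₀ T) (LinearMap.ker p).subtype)).hom
    let g := ((ModuleCat.restrictScalars ρ).map (ModuleCat.ofHom (X := N →₀ T) p)).hom
    have hf : Function.Injective f := Submodule.subtype_injective (LinearMap.ker p)
    have hfg : Function.Exact f g := LinearMap.exact_subtype_ker_map p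
    have hg : Function.Surjective g := hp
    exact PdLE.right hf hfg hg (k := s + k) h₁' (PdLE.mono (hfree N) (by omega))

/-- Along a surjection `ρ : S → T`, the projective dimension of an `S`-module killed by `ker ρ` is
at most the projective dimension of `T` over `S` plus the global dimension of `T`. -/
theorem pd_le_of_surjective {S T : Type u} [Ring S] [Ring T] {ρ : S →+* T}
    (hρ : Function.Surjective ρ) {s m : ℕ}
    (hT : HasProjectiveDimensionLE ((ModuleCat.restrictScalars ρ).obj (ModuleCat.of T T)) s)
    (hm : gldim T ≤ m) {N : Type u} [AddCommGroup N] [Module S N]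
    (hN : ∀ b : S, ρ b = 0 → ∀ x : N, b • x = 0) : PdLE S N (s + m) := by
  let φ : T →+* AddMonoid.End N :=
    ρ.liftOfRightInverse (Function.surjInv hρ) (Function.rightInverse_surjInv hρ)
      ⟨Module.toAddMonoidEnd S N, fun b hb => AddMonoidHom.ext (hN b hb)⟩
  have hφ : ∀ b, φ (ρ b) = Module.toAddMonoidEnd S N b := fun b =>
    ρ.liftOfRightInverse_comp_apply (Function.surjInv hρ) (Function.rightInverse_surjInv hρ)
      ⟨Module.toAddMonoidEnd S N, fun b hb => AddMonoidHom.ext (hN b hb)⟩ b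
  let : Module T N := Module.compHom N φ
  have h := pd_restrictScalars ρ hT (ModuleCat.of T N) (gldim_le_iff.1 hm N)
  refine PdLE.of_equiv (N₁ := (ModuleCat.restrictScalars ρ).obj (ModuleCat.of T N)) h
    { AddEquiv.refl N with map_smul' := fun b x => ?_ }
  exact DFunLike.congr_fun (hφ b) x


/-! ### Modules over a corner ring -/

section Corner

variable {A B : Type u} [Ring A] [Ring B] (Φ : A →ₙ+* B)

/-- For a multiplicative map `Φ : A → B` that need not preserve the unit, with idempotent
`e = Φ 1`, the additive subgroup `eN` of a `B`-module `N`. -/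
def cornerSubgroup (N : Type u) [AddCommGroup N] [Module B N] : AddSubgroup N where
  carrier := {x | Φ 1 • x = x}
  add_mem' {x y} hx hy := by
    rw [Set.mem_ofPred_eq] at *
    rw [smul_add, hx, hy]
  zero_mem' := smul_zero _
  neg_mem' {x} hx := by
    rw [Set.mem_ofPred_eq] at *
    rw [smul_neg, hx]

/-- The `A`-module `eN` attached to a `B`-module `N`, where `e = Φ 1`. -/
def Corner (N : Type u) [AddCommGroup N] [Module B N] : Type u := cornerSubgroup Φ N

section

variable {N N' N'' : Type u} [AddCommGroup N] [Module B N] [AddCommGroup N'] [Module B N']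
  [AddCommGroup N''] [Module B N'']

instance : AddCommGroup (Corner Φ N) := inferInstanceAs (AddCommGroup (cornerSubgroup Φ N))

theorem map_one_mul_map (a : A) : Φ 1 * Φ a = Φ a := by rw [← map_mul, one_mul]

theorem map_mul_map_one (a : A) : Φ a * Φ 1 = Φ a := by rw [← map_mul, mul_one]

/-- The inclusion of `eN` into `N`. -/
def Corner.val : Corner Φ N →+ N := (cornerSubgroup Φ N).subtype

variable {Φ}

/-- An element `x` with `e x = x`, as an element of `eN`. -/
def Corner.mk (x : N) (hx : Φ 1 • x = x) : Corner Φ N := ⟨x, hx⟩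

@[simp]
theorem Corner.val_mk (x : N) (hx : Φ 1 • x = x) : Corner.val Φ (Corner.mk x hx) = x := rfl

theorem Corner.smul_val (x : Corner Φ N) : Φ 1 • Corner.val Φ x = Corner.val Φ x := x.2

theorem Corner.val_injective : Function.Injective (Corner.val Φ : Corner Φ N →+ N) :=
  Subtype.val_injective

instance : Module A (Corner Φ N) where
  smul a x := Corner.mk (Φ a • Corner.val Φ x) (by rw [← mul_smul, map_one_mul_map])
  one_smul x := Corner.val_injective (Corner.smul_val x)
  mul_smul a b x := Corner.val_injective (by
    change Φ (a * b) • Corner.val Φ x = Φ a • Φ b • Corner.val Φ x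
    rw [map_mul, mul_smul])
  smul_zero a := Corner.val_injective (by
    change Φ a • Corner.val Φ (0 : Corner Φ N) = Corner.val Φ 0
    rw [map_zero, smul_zero])
  smul_add a x y := Corner.val_injective (by
    change Φ a • Corner.val Φ (x + y) = Corner.val Φ _
    rw [map_add, smul_add, map_add]; rfl)
  add_smul a b x := Corner.val_injective (by
    change Φ (a + b) • Corner.val Φ x = Corner.val Φ _
    rw [map_add, add_smul, map_add]; rfl)
  zero_smul x := Corner.val_injective (by
    change Φ 0 • Corner.val Φ x = Corner.val Φ 0
    rw [map_zero, zero_smul, map_zero])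

@[simp]
theorem Corner.val_smul (a : A) (x : Corner Φ N) :
    Corner.val Φ (a • x) = Φ a • Corner.val Φ x := rfl

variable (Φ) in
/-- The map `eN → eN'` induced by a `B`-linear map `N → N'`. -/
def Corner.map (f : N →ₗ[B] N') : Corner Φ N →ₗ[A] Corner Φ N' where
  toFun x := Corner.mk (f (Corner.val Φ x)) (by rw [← map_smul, Corner.smul_val])
  map_add' x y := Corner.val_injective (by
    change f (Corner.val Φ (x + y)) = Corner.val Φ _
    rw [map_add, map_add, map_add]; rfl)
  map_smul' a x := Corner.val_injective (f.map_smul (Φ a) _)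

@[simp]
theorem Corner.val_map (f : N →ₗ[B] N') (x : Corner Φ N) :
    Corner.val Φ (Corner.map Φ f x) = f (Corner.val Φ x) := rfl

theorem Corner.map_injective {f : N →ₗ[B] N'} (hf : Function.Injective f) :
    Function.Injective (Corner.map Φ f) := fun _ _ h =>
  Corner.val_injective (hf (congrArg (Corner.val Φ) h))

theorem Corner.map_surjective {f : N →ₗ[B] N'} (hf : Function.Surjective f) :
    Function.Surjective (Corner.map Φ f) := fun y => by
  obtain ⟨x, hx⟩ := hf (Corner.val Φ y)
  refine ⟨Corner.mk (Φ 1 • x) (by rw [← mul_smul, map_one_mul_map]), Corner.val_injective ?_⟩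
  rw [Corner.val_map, Corner.val_mk, map_smul, hx, Corner.smul_val]

theorem Corner.map_exact {f : N →ₗ[B] N'} {g : N' →ₗ[B] N''} (h : Function.Exact f g) :
    Function.Exact (Corner.map Φ f) (Corner.map Φ g) := fun y => by
  refine ⟨fun hy => ?_, ?_⟩
  · obtain ⟨x, hx⟩ := (h (Corner.val Φ y)).1 (congrArg (Corner.val Φ) hy)
    refine ⟨Corner.mk (Φ 1 • x) (by rw [← mul_smul, map_one_mul_map]), Corner.val_injective ?_⟩
    rw [Corner.val_map, Corner.val_mk, map_smul, hx, Corner.smul_val]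
  · rintro ⟨x, rfl⟩
    exact Corner.val_injective (h.apply_apply_eq_zero _)

/-- Isomorphic `B`-modules have isomorphic corners. -/
def Corner.equiv (f : N ≃ₗ[B] N') : Corner Φ N ≃ₗ[A] Corner Φ N' :=
  LinearEquiv.ofBijective (Corner.map Φ f.toLinearMap)
    ⟨Corner.map_injective f.injective, Corner.map_surjective f.surjective⟩

variable (Φ N) in
/-- The `B`-submodule `BeN` of `N` generated by `eN`. -/
def cornerSpan : Submodule B N := Submodule.span B {x | Φ 1 • x = x}

theorem Corner.val_mem_cornerSpan (x : Corner Φ N) : Corner.val Φ x ∈ cornerSpan Φ N :=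
  Submodule.subset_span (Corner.smul_val x)

theorem Corner.map_subtype_cornerSpan_bijective :
    Function.Bijective (Corner.map Φ (cornerSpan Φ N).subtype) :=
  ⟨Corner.map_injective (Submodule.subtype_injective _), fun x =>
    ⟨Corner.mk ⟨Corner.val Φ x, x.val_mem_cornerSpan⟩ (Subtype.ext x.smul_val), rfl⟩⟩

variable (Φ N) in
/-- The submodule `BeN` has the same corner as `N`. -/
def cornerCornerSpanEquiv : Corner Φ (cornerSpan Φ N) ≃ₗ[A] Corner Φ N :=
  LinearEquiv.ofBijective _ Corner.map_subtype_cornerSpan_bijective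

theorem cornerSpan_cornerSpan : cornerSpan Φ (cornerSpan Φ N) = ⊤ := by
  refine Submodule.map_injective_of_injective (Submodule.subtype_injective (cornerSpan Φ N)) ?_
  rw [Submodule.map_subtype_top]
  refine le_antisymm (Submodule.map_subtype_le _ _) (Submodule.span_le.2 fun x hx => ?_)
  exact ⟨⟨x, Submodule.subset_span hx⟩, Submodule.subset_span (Subtype.ext hx), rfl⟩

theorem corner_quotient_eq_zero (x : N ⧸ cornerSpan Φ N) (hx : Φ 1 • x = x) : x = 0 := by
  obtain ⟨y, rfl⟩ := Submodule.Quotient.mk_surjective _ x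
  rw [← hx, ← Submodule.Quotient.mk_smul, Submodule.Quotient.mk_eq_zero]
  refine Submodule.subset_span ?_
  rw [Set.mem_ofPred_eq, ← mul_smul, map_one_mul_map]

end

section

variable {F N : Type u} [AddCommGroup F] [Module B F] [AddCommGroup N] [Module B N]

/-- Suppose that `F` is projective and has no nonzero submodule killed by `e`. If `N = BeN` is a
quotient of `F` and the corner `eN` is projective, then `N` is projective: a section `s` of
`eF → eN` extends to a section `∑ bᵢ nᵢ ↦ ∑ bᵢ s(nᵢ)` of `F → N`. -/
theorem projective_of_projective_corner (hrange : ∀ b : B, ∃ a : A, Φ a = Φ 1 * b * Φ 1)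
    [Module.Projective B F] (hF : ∀ x : F, (∀ b : B, Φ 1 • b • x = 0) → x = 0)
    (p : F →ₗ[B] N) (hp : Function.Surjective p) (hN : cornerSpan Φ N = ⊤)
    [Module.Projective A (Corner Φ N)] : Module.Projective B N := by
  obtain ⟨s, hs⟩ := Module.projective_lifting_property (Corner.map Φ p) LinearMap.id
    (Corner.map_surjective hp)
  let τ : (Corner Φ N →₀ B) →ₗ[B] N := Finsupp.linearCombination B (Corner.val Φ)
  let σ : (Corner Φ N →₀ B) →ₗ[B] F := Finsupp.linearCombination B fun n => Corner.val Φ (s n)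
  have hpσ : ∀ x, p (σ x) = τ x := by
    intro x
    have : p ∘ₗ σ = τ := by
      ext n
      have := congrArg (Corner.val Φ) (LinearMap.congr_fun hs n)
      simpa [σ, τ] using this
    exact LinearMap.congr_fun this x
  have hτ : Function.Surjective τ := by
    rw [← LinearMap.range_eq_top, ← top_le_iff, ← hN, cornerSpan, Submodule.span_le]
    intro x hx
    exact ⟨Finsupp.single (Corner.mk x hx) 1, by simp [τ]⟩
  -- The corners of `τ` and `σ` are linked by the section `s`.
  have key : ∀ (x : Corner Φ N →₀ B) (b : B), ∃ t : Corner Φ N,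
      Corner.val Φ t = Φ 1 • b • τ x ∧ Corner.val Φ (s t) = Φ 1 • b • σ x := by
    intro x b
    induction x using Finsupp.induction_linear with
    | zero => exact ⟨0, by simp⟩
    | add x y hx hy =>
      obtain ⟨t, ht, ht'⟩ := hx
      obtain ⟨u, hu, hu'⟩ := hy
      exact ⟨t + u, by simp [ht, hu], by simp [ht', hu']⟩
    | single n r =>
      obtain ⟨a, ha⟩ := hrange (b * r)
      have h : ∀ {Q : Type u} [AddCommGroup Q] [Module B Q] (q : Corner Φ Q),
          Φ a • Corner.val Φ q = Φ 1 • b • r • Corner.val Φ q := by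
        intro Q _ _ q
        rw [ha, mul_smul, mul_smul, mul_smul, Corner.smul_val]
      exact ⟨a • n, by simp [τ, h], by simp [σ, h]⟩
  have hker : LinearMap.ker τ ≤ LinearMap.ker σ := by
    intro x hx
    refine hF _ fun b => ?_
    obtain ⟨t, ht, ht'⟩ := key x b
    have : t = 0 := Corner.val_injective (by rw [ht, LinearMap.mem_ker.1 hx]; simp)
    rw [← ht', this, map_zero, map_zero]
  let s' : N →ₗ[B] F :=
    (LinearMap.ker τ).liftQ σ hker ∘ₗ (τ.quotKerEquivOfSurjective hτ).symm.toLinearMap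
  refine Module.Projective.of_split s' p (LinearMap.ext fun y => ?_)
  obtain ⟨x, rfl⟩ := hτ y
  have : (τ.quotKerEquivOfSurjective hτ).symm (τ x) = Submodule.Quotient.mk x := by
    rw [LinearEquiv.symm_apply_eq]; rfl
  simp [s', this, hpσ]

end

/-- The properties of direct sums of copies of `Be` used below: such a module `F` is projective,
its corner `eF` is projective over `A`, and it has no nonzero submodule killed by `e`. -/
structure IsCornerProjective (Φ : A →ₙ+* B) (F : Type u) [AddCommGroup F] [Module B F] :
    Prop where
  projective : Module.Projective B F
  corner : Module.Projective A (Corner Φ F)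
  eq_zero : ∀ x : F, (∀ b : B, Φ 1 • b • x = 0) → x = 0

section

variable {F F' N : Type u} [AddCommGroup F] [Module B F] [AddCommGroup F'] [Module B F']
  [AddCommGroup N] [Module B N] {Φ}

theorem IsCornerProjective.of_equiv (h : IsCornerProjective Φ F) (f : F ≃ₗ[B] F') :
    IsCornerProjective Φ F' where
  projective := have := h.projective; Module.Projective.of_equiv' f
  corner := have := h.corner; Module.Projective.of_equiv' (Corner.equiv f)
  eq_zero x hx := by
    rw [← f.symm.map_eq_zero_iff]
    refine h.eq_zero _ fun b => ?_
    rw [← map_smul, ← map_smul, hx, map_zero]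

theorem IsCornerProjective.finsupp (h : IsCornerProjective Φ F) (ι : Type u) :
    IsCornerProjective Φ (ι →₀ F) where
  projective := have := h.projective; projective_finsupp ι B F
  corner := by
    have := h.corner
    have := projective_finsupp ι A (Corner Φ F)
    let f : (ι →₀ Corner Φ F) →+ (ι →₀ F) := Finsupp.mapRange.addMonoidHom (Corner.val Φ)
    have hf : ∀ x, Φ 1 • f x = f x := fun x => Finsupp.ext fun i => Corner.smul_val (x i)
    let g : (ι →₀ Corner Φ F) →ₗ[A] Corner Φ (ι →₀ F) :=
      { toFun := fun x => Corner.mk (f x) (hf x)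
        map_add' := fun x y => Corner.val_injective (map_add f x y)
        map_smul' := fun a x => Corner.val_injective (Finsupp.ext fun i => rfl) }
    refine Module.Projective.of_equiv' (LinearEquiv.ofBijective g ⟨fun x y hxy => ?_, fun y => ?_⟩)
    · exact Finsupp.mapRange_injective _ (map_zero _) Corner.val_injective
        (congrArg (Corner.val Φ) hxy)
    · classical
      refine ⟨Finsupp.onFinset (Corner.val Φ y).support (fun i => Corner.mk (Corner.val Φ y i)
        (DFunLike.congr_fun y.smul_val i)) fun i hi => ?_,
        Corner.val_injective (Finsupp.ext fun i => rfl)⟩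
      rw [Finsupp.mem_support_iff]
      exact fun h0 => hi (Corner.val_injective h0)
  eq_zero x hx := Finsupp.ext fun i => h.eq_zero _ fun b => DFunLike.congr_fun (hx b) i

theorem isCornerProjective_span (hinj : Function.Injective Φ)
    (hrange : ∀ b : B, ∃ a : A, Φ a = Φ 1 * b * Φ 1)
    (hB : ∀ x : B, x * Φ 1 = x → (∀ b, Φ 1 * b * x = 0) → x = 0) :
    IsCornerProjective Φ (Submodule.span B {Φ 1}) := by
  have hmul : ∀ x ∈ Submodule.span B {Φ 1}, x * Φ 1 = x := by
    intro x hx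
    obtain ⟨b, rfl⟩ := Submodule.mem_span_singleton.1 hx
    rw [smul_eq_mul, mul_assoc, map_one_mul_map]
  refine ⟨?_, ?_, fun x hx => ?_⟩
  · refine Module.Projective.of_split (Submodule.span B {Φ 1}).subtype
      ((LinearMap.toSpanSingleton B B (Φ 1)).codRestrict _ fun b =>
        Submodule.mem_span_singleton.2 ⟨b, rfl⟩) (LinearMap.ext fun x => Subtype.ext ?_)
    exact hmul x x.2
  · let g : A →ₗ[A] Corner Φ (Submodule.span B {Φ 1}) :=
      { toFun := fun a => Corner.mk ⟨Φ a, Submodule.mem_span_singleton.2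
          ⟨Φ a, map_mul_map_one Φ a⟩⟩ (Subtype.ext (map_one_mul_map Φ a))
        map_add' := fun a b => Corner.val_injective (Subtype.ext (map_add Φ a b))
        map_smul' := fun a b => Corner.val_injective (Subtype.ext (map_mul Φ a b)) }
    refine Module.Projective.of_equiv' (LinearEquiv.ofBijective g ⟨fun a b hab => ?_, fun y => ?_⟩)
    · exact hinj (congrArg Subtype.val (congrArg (Corner.val Φ) hab))
    · obtain ⟨a, ha⟩ := hrange (Corner.val Φ y).1
      refine ⟨a, Corner.val_injective (Subtype.ext ?_)⟩
      change Φ a = _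
      rw [ha, mul_assoc, hmul _ (Corner.val Φ y).2]
      exact congrArg Subtype.val y.smul_val
  · exact Subtype.ext (hB _ (hmul _ x.2) fun b => by
      rw [mul_assoc]; exact congrArg Subtype.val (hx b))

/-- `BeN` is a quotient of a direct sum of copies of `Be`. -/
theorem exists_surjective_cornerSpan (N : Type u) [AddCommGroup N] [Module B N] :
    ∃ p : (Corner Φ N →₀ Submodule.span B {Φ 1}) →ₗ[B] cornerSpan Φ N, Function.Surjective p := by
  let q (n : Corner Φ N) : Submodule.span B {Φ 1} →ₗ[B] cornerSpan Φ N :=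
    ((LinearMap.toSpanSingleton B N (Corner.val Φ n)).codRestrict (cornerSpan Φ N) fun b =>
      Submodule.smul_mem _ b n.val_mem_cornerSpan) ∘ₗ (Submodule.span B {Φ 1}).subtype
  refine ⟨Finsupp.lsum ℕ q, ?_⟩
  rw [← LinearMap.range_eq_top]
  refine Submodule.map_injective_of_injective (Submodule.subtype_injective (cornerSpan Φ N)) ?_
  rw [Submodule.map_subtype_top]
  refine le_antisymm (Submodule.map_subtype_le _ _) (Submodule.span_le.2 fun x hx => ?_)
  refine ⟨⟨x, Submodule.subset_span hx⟩, ⟨Finsupp.single (Corner.mk x hx)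
    ⟨Φ 1, Submodule.mem_span_singleton_self _⟩, ?_⟩, rfl⟩
  rw [Finsupp.lsum_single]
  exact Subtype.ext hx

/-- If all modules `N` with `eN = 0` have projective dimension at most `t`, then the projective
dimension of an arbitrary `N` is at most `t` plus that of the `A`-module `eN`. -/
theorem pd_le_of_corner (hinj : Function.Injective Φ)
    (hrange : ∀ b : B, ∃ a : A, Φ a = Φ 1 * b * Φ 1)
    (hB : ∀ x : B, x * Φ 1 = x → (∀ b, Φ 1 * b * x = 0) → x = 0) {t : ℕ}
    (ht : ∀ (N : Type u) [AddCommGroup N] [Module B N], (∀ x : N, Φ 1 • x = x → x = 0) →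
      PdLE B N t) {k : ℕ} :
    ∀ {N : Type u} [AddCommGroup N] [Module B N], PdLE A (Corner Φ N) k →
      PdLE B N (t + k) := by
  have hE := isCornerProjective_span hinj hrange hB
  -- It suffices to bound the projective dimension of `BeN`.
  suffices H : ∀ {N : Type u} [AddCommGroup N] [Module B N], PdLE A (Corner Φ N) k →
      PdLE B (cornerSpan Φ N) (t + k) by
    intro N _ _ h
    exact PdLE.middle (Submodule.subtype_injective (cornerSpan Φ N))
      (LinearMap.exact_subtype_mkQ _) (Submodule.mkQ_surjective _) (H h)
      ((ht _ corner_quotient_eq_zero).mono (by omega))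
  induction k with
  | zero =>
    intro N _ _ h
    obtain ⟨p, hp⟩ := exists_surjective_cornerSpan (Φ := Φ) N
    have hF := hE.finsupp (Corner Φ N)
    have := hF.projective
    have := pdLE_zero_iff.1 (h.of_equiv (cornerCornerSpanEquiv Φ N).symm)
    have := projective_of_projective_corner Φ hrange hF.eq_zero p hp cornerSpan_cornerSpan
    exact PdLE.of_projective _
  | succ k ih =>
    intro N _ _ h
    obtain ⟨p, hp⟩ := exists_surjective_cornerSpan (Φ := Φ) N
    have hF := hE.finsupp (Corner Φ N)
    have := hF.projective
    have := hF.corner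
    have h₁ : PdLE A (Corner Φ (LinearMap.ker p)) k :=
      PdLE.left (Corner.map_injective (Submodule.subtype_injective _))
        (Corner.map_exact (LinearMap.exact_subtype_ker_map p)) (Corner.map_surjective hp)
        (PdLE.of_projective k) (h.of_equiv (cornerCornerSpanEquiv Φ N).symm)
    have h₂ : PdLE B (LinearMap.ker p) (t + k) :=
      PdLE.middle (Submodule.subtype_injective (cornerSpan Φ (LinearMap.ker p)))
        (LinearMap.exact_subtype_mkQ _) (Submodule.mkQ_surjective _) (ih h₁)
        ((ht _ corner_quotient_eq_zero).mono (by omega))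
    exact PdLE.right (Submodule.subtype_injective _) (LinearMap.exact_subtype_ker_map p) hp
      (k := t + k) h₂ (PdLE.of_projective _)

end

end Corner


/-! ### Finiteness over a noether algebra -/

section Noether

variable {R : Type u} [Ring R]

/-- Multiplication by a central element, as a linear endomorphism. -/
def centralSMul (L : Type u) [AddCommGroup L] [Module R L] (z : Subring.center R) : L →ₗ[R] L where
  toFun x := z • x
  map_add' := smul_add z
  map_smul' r x := by
    change (z : R) • r • x = r • (z : R) • x
    rw [← mul_smul, ← mul_smul, Subring.mem_center_iff.1 z.2 r]

@[simp]
theorem centralSMul_apply {L : Type u} [AddCommGroup L] [Module R L] (z : Subring.center R)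
    (x : L) : centralSMul L z x = z • x := rfl

variable (hR : IsNoetherAlgebra R)
include hR

theorem IsNoetherAlgebra.isNoetherian_center (L : Type u) [AddCommGroup L] [Module R L]
    [Module.Finite R L] : IsNoetherian (Subring.center R) L := by
  have := hR.noetherian_center
  have := hR.finite_over_center
  have : Module.Finite (Subring.center R) L := Module.Finite.trans R L
  infer_instance

theorem IsNoetherAlgebra.isNoetherian (L : Type u) [AddCommGroup L] [Module R L]
    [Module.Finite R L] : IsNoetherian R L :=
  have := hR.isNoetherian_center L
  isNoetherian_of_tower (Subring.center R) inferInstance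

theorem IsNoetherAlgebra.finite_ker {L L' : Type u} [AddCommGroup L] [Module R L]
    [Module.Finite R L] [AddCommGroup L'] [Module R L'] (f : L →ₗ[R] L') :
    Module.Finite R (LinearMap.ker f) :=
  have := hR.isNoetherian L
  inferInstance

/-- Over a noether algebra, `Hom_R(M, L)` is finitely generated over the centre. -/
theorem IsNoetherAlgebra.exists_generators (M L : Type u) [AddCommGroup M] [Module R M]
    [Module.Finite R M] [AddCommGroup L] [Module R L] [Module.Finite R L] :
    ∃ (J : Type u) (_ : Fintype J) (h : J → M →ₗ[R] L), ∀ φ : M →ₗ[R] L,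
      ∃ z : J → Subring.center R, φ = ∑ j, centralSMul L (z j) ∘ₗ h j := by
  obtain ⟨n, x, hx⟩ := Module.Finite.exists_fin (R := R) (M := M)
  let H : Submodule (Subring.center R) (Fin n → L) :=
    { carrier := {y | ∃ φ : M →ₗ[R] L, ∀ i, y i = φ (x i)}
      add_mem' := by
        rintro y y' ⟨φ, hφ⟩ ⟨φ', hφ'⟩
        exact ⟨φ + φ', fun i => by simp [hφ, hφ']⟩
      zero_mem' := ⟨0, fun i => rfl⟩
      smul_mem' := by
        rintro z y ⟨φ, hφ⟩
        exact ⟨centralSMul L z ∘ₗ φ, fun i => by simp [hφ]⟩ }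
  have := hR.isNoetherian_center L
  obtain ⟨s, hs⟩ := IsNoetherian.noetherian H
  have hmem : ∀ y : s, ∃ φ : M →ₗ[R] L, ∀ i, y.1 i = φ (x i) := fun y =>
    hs.le (Submodule.subset_span y.2)
  choose h hh using hmem
  refine ⟨s, inferInstance, h, fun φ => ?_⟩
  have hφ : (fun i => φ (x i)) ∈ Submodule.span (Subring.center R)
      (Set.range (Subtype.val : s → Fin n → L)) := by
    rw [Subtype.range_coe]
    exact hs.ge ⟨φ, fun i => rfl⟩
  obtain ⟨z, hz⟩ := (Submodule.mem_span_range_iff_exists_fun _).1 hφ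
  refine ⟨z, LinearMap.ext_on hx ?_⟩
  rintro _ ⟨i, rfl⟩
  have := congrFun hz i
  simp only [Finset.sum_apply, Pi.smul_apply] at this
  simp [← this, hh]

/-- A right `add M`-approximation of a finitely generated module `L`. -/
theorem IsNoetherAlgebra.exists_approximation (M L : Type u) [AddCommGroup M] [Module R M]
    [Module.Finite R M] [AddCommGroup L] [Module R L] [Module.Finite R L] :
    ∃ (J : Type u) (_ : Fintype J) (a : (J → M) →ₗ[R] L), ∀ φ : M →ₗ[R] L,
      ∃ v : M →ₗ[R] (J → M), a ∘ₗ v = φ := by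
  obtain ⟨J, hJ, h, hh⟩ := hR.exists_generators M L
  refine ⟨J, hJ, ∑ j, h j ∘ₗ LinearMap.proj j, fun φ => ?_⟩
  obtain ⟨z, rfl⟩ := hh φ
  refine ⟨LinearMap.pi fun j => centralSMul M (z j), LinearMap.ext fun x => ?_⟩
  have (j : J) : h j (z j • x) = z j • h j x := (h j).map_smul (z j : R) x
  simp [this]

/-- A left approximation of a finitely generated module `M` by a free module. -/
theorem IsNoetherAlgebra.exists_free_approximation (M : Type u) [AddCommGroup M] [Module R M]
    [Module.Finite R M] :
    ∃ (J : Type u) (_ : Fintype J) (h : M →ₗ[R] (J → R)), ∀ φ : M →ₗ[R] R,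
      ∃ ψ : (J → R) →ₗ[R] R, ψ ∘ₗ h = φ := by
  have : Module.Finite R R := inferInstance
  obtain ⟨J, hJ, h, hh⟩ := hR.exists_generators M R
  refine ⟨J, hJ, LinearMap.pi h, fun φ => ?_⟩
  obtain ⟨z, rfl⟩ := hh φ
  exact ⟨∑ j, centralSMul R (z j) ∘ₗ LinearMap.proj j, LinearMap.ext fun x => by simp⟩

end Noether

theorem exists_retract_free {R : Type u} [Ring R] (P : Type u) [AddCommGroup P] [Module R P]
    [Module.Finite R P] [Module.Projective R P] :
    ∃ (n : ℕ) (s : P →ₗ[R] (Fin n → R)) (p : (Fin n → R) →ₗ[R] P), p ∘ₗ s = LinearMap.id := by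
  obtain ⟨n, p, hp⟩ := Module.Finite.exists_fin' R P
  obtain ⟨s, hs⟩ := Module.projective_lifting_property p LinearMap.id hp
  exact ⟨n, s, p, hs⟩

/-! ### Vanishing of extension groups -/

section Ext

variable {S : Type u} [Ring S] {X Y : Type u} [AddCommGroup X] [Module S X] [AddCommGroup Y]
  [Module S Y]

/-- `Ext^i_S(X, Y) = 0`. -/
abbrev ExtVanishes (S : Type u) [Ring S] (X Y : Type u) [AddCommGroup X] [Module S X]
    [AddCommGroup Y] [Module S Y] (i : ℕ) : Prop :=
  Subsingleton (Ext (ModuleCat.of S X) (ModuleCat.of S Y) i)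

theorem extVanishes_of_lt_moduleGrade {i : ℕ} (h : (i : ℕ∞) < moduleGrade S X) :
    ExtVanishes S X S i := by
  by_contra hn
  rw [not_subsingleton_iff_nontrivial] at hn
  exact absurd (iInf₂_le i hn) (not_le.2 h)

theorem ExtVanishes.of_projective [Module.Projective S X] (i : ℕ) : ExtVanishes S X Y (i + 1) :=
  have := (IsProjective.iff_projective (R := S) (P := X)).1 inferInstance
  Ext.subsingleton_of_projective _ _ _

theorem extVanishes_zero_iff : ExtVanishes S X Y 0 ↔ ∀ f : X →ₗ[S] Y, f = 0 := by
  refine ⟨fun h f => ?_, fun h => subsingleton_of_forall_eq 0 fun x => ?_⟩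
  · have := (Ext.mk₀_eq_zero_iff (ModuleCat.ofHom f)).1 (Subsingleton.elim _ _)
    exact congrArg ModuleCat.Hom.hom this
  · obtain ⟨f, rfl⟩ := (Ext.mk₀_bijective _ _).2 x
    rw [Ext.mk₀_eq_zero_iff]
    exact ModuleCat.hom_ext (h f.hom)

section Retract

variable {Y' : Type u} [AddCommGroup Y'] [Module S Y'] {i : ℕ}

/-- Vanishing of `Ext^i(X, -)` passes to direct summands of finite direct sums. -/
theorem ExtVanishes.of_sum_comp_eq_id {J : Type*} [Fintype J] (h : ExtVanishes S X Y' i)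
    (s : J → Y →ₗ[S] Y') (p : J → Y' →ₗ[S] Y) (hps : ∑ j, p j ∘ₗ s j = LinearMap.id) :
    ExtVanishes S X Y i := by
  refine subsingleton_of_forall_eq 0 fun x => ?_
  have h1 : (𝟙 (ModuleCat.of S Y)) = ∑ j, ModuleCat.ofHom (s j) ≫ ModuleCat.ofHom (p j) := by
    ext y
    have := LinearMap.congr_fun hps y
    simpa [ModuleCat.hom_sum] using this.symm
  rw [← x.comp_mk₀_id, h1, Ext.mk₀_sum, Ext.comp_sum]
  refine Finset.sum_eq_zero fun j _ => ?_
  rw [← Ext.mk₀_comp_mk₀, ← Ext.comp_assoc_of_third_deg_zero,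
    Subsingleton.elim (x.comp (Ext.mk₀ (ModuleCat.ofHom (s j))) _) 0, Ext.zero_comp]

theorem ExtVanishes.pi (J : Type u) [Fintype J] (h : ExtVanishes S X Y i) :
    ExtVanishes S X (J → Y) i := by
  classical
  refine h.of_sum_comp_eq_id (fun j => LinearMap.proj j)
    (fun j => LinearMap.single S (fun _ : J => Y) j) ?_
  exact LinearMap.ext fun y => by simp [LinearMap.sum_apply, Finset.univ_sum_single]

theorem ExtVanishes.of_finite_projective (h : ExtVanishes S X S i) [Module.Finite S Y]
    [Module.Projective S Y] : ExtVanishes S X Y i := by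
  classical
  obtain ⟨n, s, p, hps⟩ := exists_retract_free (R := S) Y
  refine h.of_sum_comp_eq_id (fun j => LinearMap.proj j ∘ₗ s)
    (fun j => p ∘ₗ LinearMap.single S (fun _ : Fin n => S) j) (LinearMap.ext fun y => ?_)
  have := LinearMap.congr_fun hps y
  conv_rhs => rw [← this]
  simp [LinearMap.sum_apply, ← map_sum, Finset.univ_sum_single]

end Retract

section LongExact

variable {N₁ N₂ N₃ : Type u} [AddCommGroup N₁] [Module S N₁] [AddCommGroup N₂] [Module S N₂]
  [AddCommGroup N₃] [Module S N₃] {f : N₁ →ₗ[S] N₂} {g : N₂ →ₗ[S] N₃}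
  (hf : Function.Injective f) (hfg : Function.Exact f g) (hg : Function.Surjective g) {i : ℕ}
include hf hfg hg

theorem ExtVanishes.left_succ (h₃ : ExtVanishes S X N₃ i) (h₂ : ExtVanishes S X N₂ (i + 1)) :
    ExtVanishes S X N₁ (i + 1) := by
  refine subsingleton_of_forall_eq 0 fun x => ?_
  obtain ⟨y, rfl⟩ := Ext.covariant_sequence_exact₁ _ (shortExact_moduleCat hf hfg hg) x
    (h₂.elim _ _) rfl
  rw [h₃.elim y 0, Ext.zero_comp]

theorem ExtVanishes.middle (h₁ : ExtVanishes S X N₁ i) (h₃ : ExtVanishes S X N₃ i) :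
    ExtVanishes S X N₂ i := by
  refine subsingleton_of_forall_eq 0 fun x => ?_
  obtain ⟨y, rfl⟩ := Ext.covariant_sequence_exact₂ _ (shortExact_moduleCat hf hfg hg) x
    (h₃.elim _ _)
  rw [h₁.elim y 0, Ext.zero_comp]

theorem ExtVanishes.source_left (h₂ : ExtVanishes S N₂ Y i) (h₃ : ExtVanishes S N₃ Y (i + 1)) :
    ExtVanishes S N₁ Y i := by
  refine subsingleton_of_forall_eq 0 fun x => ?_
  obtain ⟨y, rfl⟩ := Ext.contravariant_sequence_exact₁ (shortExact_moduleCat hf hfg hg) _ x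
    (add_comm 1 i) (h₃.elim _ _)
  rw [h₂.elim y 0, Ext.comp_zero]

theorem ExtVanishes.source_right (h₁ : ExtVanishes S N₁ Y i) (h₂ : ExtVanishes S N₂ Y (i + 1)) :
    ExtVanishes S N₃ Y (i + 1) := by
  refine subsingleton_of_forall_eq 0 fun x => ?_
  obtain ⟨y, rfl⟩ := Ext.contravariant_sequence_exact₃ (shortExact_moduleCat hf hfg hg) _ x
    (h₂.elim _ _) (add_comm 1 i)
  rw [h₁.elim y 0, Ext.comp_zero]

theorem exists_extension_of_extVanishes (h : ExtVanishes S N₃ Y 1) (φ : N₁ →ₗ[S] Y) :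
    ∃ ψ : N₂ →ₗ[S] Y, ψ ∘ₗ f = φ := by
  obtain ⟨y, hy⟩ := Ext.contravariant_sequence_exact₁ (shortExact_moduleCat hf hfg hg) _
    (Ext.mk₀ (ModuleCat.ofHom φ)) (add_zero 1) (h.elim _ _)
  obtain ⟨ψ, rfl⟩ := (Ext.mk₀_bijective _ _).2 y
  rw [Ext.mk₀_comp_mk₀] at hy
  exact ⟨ψ.hom, congrArg ModuleCat.Hom.hom ((Ext.mk₀_bijective _ _).1 hy)⟩

theorem extVanishes_one_of_forall_exists_extension [Module.Projective S N₂]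
    (h : ∀ φ : N₁ →ₗ[S] Y, ∃ ψ : N₂ →ₗ[S] Y, ψ ∘ₗ f = φ) : ExtVanishes S N₃ Y 1 := by
  refine subsingleton_of_forall_eq 0 fun x => ?_
  have hS := shortExact_moduleCat hf hfg hg
  obtain ⟨y, rfl⟩ := Ext.contravariant_sequence_exact₃ hS _ x
    ((ExtVanishes.of_projective (S := S) (X := N₂) (Y := Y) 0).elim _ _) (add_zero 1)
  obtain ⟨φ, rfl⟩ := (Ext.mk₀_bijective _ _).2 y
  obtain ⟨ψ, hψ⟩ := h φ.hom
  have : φ = ModuleCat.ofHom f ≫ ModuleCat.ofHom ψ :=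
    ModuleCat.hom_ext (by rw [← hψ]; rfl)
  rw [this, ← Ext.mk₀_comp_mk₀]
  exact hS.extClass_comp_assoc _

end LongExact

end Ext


/-! ### Duality for finitely generated projective modules -/

section Dual

variable {R : Type u} [Ring R] (P : Type u) [AddCommGroup P] [Module R P] [Module.Finite R P]
  [Module.Projective R P]

theorem exists_dual_basis :
    ∃ (n : ℕ) (x : Fin n → P) (φ : Fin n → P →ₗ[R] R), ∀ y, ∑ i, φ i y • x i = y := by
  classical
  obtain ⟨n, s, p, hps⟩ := exists_retract_free (R := R) P
  refine ⟨n, fun i => p (Pi.single i 1), fun i => LinearMap.proj i ∘ₗ s, fun y => ?_⟩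
  have h := LinearMap.congr_fun hps y
  refine Eq.trans ?_ h
  simp only [LinearMap.comp_apply, LinearMap.proj_apply, ← map_smul, ← map_sum]
  congr 1
  ext j
  simp [Finset.sum_apply, Pi.single_apply]

theorem eq_sum_dual_basis {P : Type u} [AddCommGroup P] [Module R P] {n : ℕ} {x : Fin n → P}
    {φ : Fin n → P →ₗ[R] R} (h : ∀ y, ∑ i, φ i y • x i = y) (ψ : P →ₗ[R] R) :
    ∑ i, MulOpposite.op (ψ (x i)) • φ i = ψ := by
  ext y
  conv_rhs => rw [← h y]
  simp [LinearMap.sum_apply]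

/-- The dual of a finitely generated projective module is projective. -/
instance projective_dual : Module.Projective Rᵐᵒᵖ (P →ₗ[R] R) := by
  obtain ⟨n, x, φ, h⟩ := exists_dual_basis (R := R) P
  let s : (P →ₗ[R] R) →ₗ[Rᵐᵒᵖ] (Fin n → Rᵐᵒᵖ) :=
    { toFun := fun ψ i => MulOpposite.op (ψ (x i))
      map_add' := fun _ _ => rfl
      map_smul' := fun _ _ => rfl }
  let p : (Fin n → Rᵐᵒᵖ) →ₗ[Rᵐᵒᵖ] (P →ₗ[R] R) :=
    ∑ i, (LinearMap.toSpanSingleton Rᵐᵒᵖ _ (φ i)) ∘ₗ LinearMap.proj i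
  refine Module.Projective.of_split s p (LinearMap.ext fun ψ => ?_)
  simpa [p, s, LinearMap.sum_apply] using eq_sum_dual_basis h ψ

variable {P}

/-- Evaluation at an element, as a map of right modules `Hom_R(P, R) → R`. -/
def dualEval {P : Type u} [AddCommGroup P] [Module R P] (y : P) : (P →ₗ[R] R) →ₗ[Rᵐᵒᵖ] R where
  toFun ψ := ψ y
  map_add' _ _ := rfl
  map_smul' _ _ := rfl

/-- A finitely generated projective module is reflexive. -/
theorem exists_eq_dualEval (h : (P →ₗ[R] R) →ₗ[Rᵐᵒᵖ] R) : ∃ y : P, h = dualEval y := by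
  obtain ⟨n, x, φ, hx⟩ := exists_dual_basis (R := R) P
  refine ⟨∑ i, h (φ i) • x i, LinearMap.ext fun ψ => ?_⟩
  conv_lhs => rw [← eq_sum_dual_basis hx ψ]
  simp [dualEval]

theorem eq_of_forall_dual_eq {y z : P} (h : ∀ φ : P →ₗ[R] R, φ y = φ z) : y = z := by
  obtain ⟨n, x, φ, hx⟩ := exists_dual_basis (R := R) P
  rw [← hx y, ← hx z]
  simp [h]

end Dual

/-! ### Torsionfree modules -/

section Torsionfree

variable {R : Type u} [Ring R]

section Transpose

variable {P Q F : Type u} [AddCommGroup P] [Module R P] [AddCommGroup Q] [Module R Q]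
  [AddCommGroup F] [Module R F] {f : P →ₗ[R] Q} {v : Q →ₗ[R] F} (hvf : v ∘ₗ f = 0)
  (hv : ∀ φ : Q →ₗ[R] R, φ ∘ₗ f = 0 → ∃ ψ : F →ₗ[R] R, ψ ∘ₗ v = φ)

include hvf hv in
theorem ker_dualMap_eq_range : LinearMap.ker (dualMap f) = LinearMap.range (dualMap v) := by
  ext φ
  refine ⟨fun h => hv φ h, ?_⟩
  rintro ⟨ψ, rfl⟩
  change (ψ ∘ₗ v) ∘ₗ f = 0
  rw [LinearMap.comp_assoc, hvf, LinearMap.comp_zero]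

include hvf in
theorem range_dualMap_le_ker : LinearMap.range (dualMap v) ≤ LinearMap.ker (dualMap f) := by
  rintro _ ⟨ψ, rfl⟩
  change (ψ ∘ₗ v) ∘ₗ f = 0
  rw [LinearMap.comp_assoc, hvf, LinearMap.comp_zero]

/-- For composable maps `P → Q → F` with zero composite, the map from the cokernel of
`Hom(F, R) → Hom(Q, R)` to `Hom(P, R)`. -/
def transposeMap : TransposeOf v →ₗ[Rᵐᵒᵖ] (P →ₗ[R] R) :=
  (LinearMap.range (dualMap v)).liftQ (dualMap f) (range_dualMap_le_ker hvf)

include hv in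
theorem transposeMap_injective : Function.Injective (transposeMap hvf) := by
  rw [← LinearMap.ker_eq_bot]
  exact Submodule.ker_liftQ_eq_bot _ _ _ (ker_dualMap_eq_range hvf hv).le

theorem transposeMap_exact :
    Function.Exact (transposeMap hvf) (LinearMap.range (dualMap f)).mkQ := by
  rw [LinearMap.exact_iff, Submodule.ker_mkQ, transposeMap, Submodule.range_liftQ]

include hvf hv in
/-- Dimension shifting between the transposes of a module and of a cosyzygy. -/
theorem extVanishes_transpose_succ_iff [Module.Finite R P] [Module.Projective R P]
    (i : ℕ) :
    ExtVanishes Rᵐᵒᵖ (TransposeOf f) R (i + 2) ↔ ExtVanishes Rᵐᵒᵖ (TransposeOf v) R (i + 1) := by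
  have hi := transposeMap_injective hvf hv
  have he := transposeMap_exact hvf
  have hs := Submodule.mkQ_surjective (LinearMap.range (dualMap f))
  exact ⟨fun h => ExtVanishes.source_left hi he hs (ExtVanishes.of_projective i) h,
    fun h => ExtVanishes.source_right hi he hs h (ExtVanishes.of_projective (i + 1))⟩

variable [Module.Finite R P] [Module.Projective R P] [Module.Finite R Q] [Module.Projective R Q]
  [Module.Finite R F] [Module.Projective R F]

include hvf hv in
/-- Auslander's criterion: `Ext¹(Tr M, R) = 0` if and only if `M` is torsionless. -/
theorem extVanishes_transpose_one_iff :
    ExtVanishes Rᵐᵒᵖ (TransposeOf f) R 1 ↔ Function.Exact f v := by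
  have hi := transposeMap_injective hvf hv
  have he := transposeMap_exact hvf
  have hs := Submodule.mkQ_surjective (LinearMap.range (dualMap f))
  refine ⟨fun h y => ⟨fun hy => ?_, ?_⟩, fun h => ?_⟩
  · have hle : LinearMap.range (dualMap v) ≤ LinearMap.ker (dualEval y) := by
      rintro _ ⟨ψ, rfl⟩
      change ψ (v y) = 0
      rw [hy, map_zero]
    obtain ⟨ψ, hψ⟩ := exists_extension_of_extVanishes hi he hs h
      ((LinearMap.range (dualMap v)).liftQ (dualEval y) hle)
    obtain ⟨x, rfl⟩ := exists_eq_dualEval ψ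
    exact ⟨x, eq_of_forall_dual_eq fun φ => LinearMap.congr_fun hψ (Submodule.Quotient.mk φ)⟩
  · rintro ⟨x, rfl⟩
    exact LinearMap.congr_fun hvf x
  · refine extVanishes_one_of_forall_exists_extension hi he hs fun φ => ?_
    obtain ⟨y, hy⟩ := exists_eq_dualEval (φ ∘ₗ (LinearMap.range (dualMap v)).mkQ)
    have hvy : v y = 0 := eq_of_forall_dual_eq fun ψ => by
      have h1 := LinearMap.congr_fun hy (dualMap v ψ)
      have h2 : (LinearMap.range (dualMap v)).mkQ (dualMap v ψ) = 0 :=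
        (Submodule.Quotient.mk_eq_zero _).2 ⟨ψ, rfl⟩
      rw [LinearMap.comp_apply, h2, map_zero] at h1
      rw [map_zero]
      exact h1.symm
    obtain ⟨x, rfl⟩ := (h y).1 hvy
    refine ⟨dualEval x, LinearMap.ext fun t => ?_⟩
    obtain ⟨ψ, rfl⟩ := Submodule.Quotient.mk_surjective _ t
    exact (LinearMap.congr_fun hy ψ).symm

end Transpose

/-- A module `M` has a *dominant cosyzygy sequence* of length `d` if there is an exact sequence
`0 → M → F₀ → ⋯ → F_{d-1}` with all `Fᵢ` finitely generated projective that stays exact under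
`Hom_R(-, R)`. Over a noether algebra this describes the `d`-torsionfree modules. -/
def HasDominantCosyzygy (R : Type u) [Ring R] :
    (d : ℕ) → (M : Type u) → [AddCommGroup M] → [Module R M] → Prop
  | 0, _, _, _ => True
  | d + 1, M, _, _ =>
    ∃ (F C : Type u) (_ : AddCommGroup F) (_ : Module R F) (_ : AddCommGroup C) (_ : Module R C)
      (j : M →ₗ[R] F) (q : F →ₗ[R] C), Module.Finite R F ∧ Module.Projective R F ∧
      Function.Injective j ∧ Function.Exact j q ∧ Function.Surjective q ∧
      (∀ φ : M →ₗ[R] R, ∃ ψ : F →ₗ[R] R, ψ ∘ₗ j = φ) ∧ HasDominantCosyzygy R d C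

theorem HasDominantCosyzygy.mono {d c : ℕ} (hcd : c ≤ d) :
    ∀ {M : Type u} [AddCommGroup M] [Module R M], HasDominantCosyzygy R d M →
      HasDominantCosyzygy R c M := by
  induction c generalizing d with
  | zero => intro M _ _ _; trivial
  | succ c ih =>
    obtain ⟨d, rfl⟩ : ∃ k, d = k + 1 := ⟨d - 1, by omega⟩
    rintro M _ _ ⟨F, C, _, _, _, _, j, q, h1, h2, h3, h4, h5, h6, h7⟩
    exact ⟨F, C, _, _, _, _, j, q, h1, h2, h3, h4, h5, h6, ih (by omega) h7⟩

theorem HasDominantCosyzygy.of_equiv {d : ℕ} {M M' : Type u} [AddCommGroup M] [Module R M]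
    [AddCommGroup M'] [Module R M'] (h : HasDominantCosyzygy R d M) (e : M' ≃ₗ[R] M) :
    HasDominantCosyzygy R d M' := by
  cases d with
  | zero => trivial
  | succ d =>
    obtain ⟨F, C, _, _, _, _, j, q, h1, h2, h3, h4, h5, h6, h7⟩ := h
    refine ⟨F, C, _, _, _, _, j ∘ₗ e.toLinearMap, q, h1, h2, h3.comp e.injective, ?_, h5,
      fun φ => ?_, h7⟩
    · rw [LinearMap.exact_iff, LinearMap.range_comp, LinearEquiv.range, Submodule.map_top,
        ← LinearMap.exact_iff]
      exact h4
    · obtain ⟨ψ, hψ⟩ := h6 (φ ∘ₗ e.symm.toLinearMap)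
      exact ⟨ψ, by rw [← LinearMap.comp_assoc, hψ]; ext x; simp⟩

theorem HasDominantCosyzygy.prod {d : ℕ} :
    ∀ {M M' : Type u} [AddCommGroup M] [Module R M] [AddCommGroup M'] [Module R M'],
      HasDominantCosyzygy R d M → HasDominantCosyzygy R d M' →
      HasDominantCosyzygy R d (M × M') := by
  induction d with
  | zero => intros; trivial
  | succ d ih =>
    rintro M M' _ _ _ _ ⟨F, C, _, _, _, _, j, q, h1, h2, h3, h4, h5, h6, h7⟩
      ⟨F', C', _, _, _, _, j', q', h1', h2', h3', h4', h5', h6', h7'⟩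
    refine ⟨F × F', C × C', _, _, _, _, j.prodMap j', q.prodMap q', inferInstance, inferInstance,
      h3.prodMap h3', ?_, h5.prodMap h5', fun φ => ?_, ih h7 h7'⟩
    · rintro ⟨x, y⟩
      simp [h4 x, h4' y, Prod.ext_iff]
    · obtain ⟨ψ, hψ⟩ := h6 (φ ∘ₗ LinearMap.inl R M M')
      obtain ⟨ψ', hψ'⟩ := h6' (φ ∘ₗ LinearMap.inr R M M')
      refine ⟨ψ.coprod ψ', LinearMap.prod_ext ?_ ?_⟩
      · rw [← hψ]; ext x; simp
      · rw [← hψ']; ext x; simp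

/-- Auslander–Bridger: for a presentation `P → Q → M → 0` by finitely generated projective
modules, `Ext^i(Tr M, R) = 0` for `1 ≤ i ≤ d` if and only if `M` has a dominant cosyzygy
sequence of length `d`. -/
theorem extVanishes_transpose_iff (hR : IsNoetherAlgebra R) {d : ℕ} :
    ∀ {P Q M : Type u} [AddCommGroup P] [Module R P] [AddCommGroup Q] [Module R Q]
      [AddCommGroup M] [Module R M] [Module.Finite R P] [Module.Projective R P]
      [Module.Finite R Q] [Module.Projective R Q] {f : P →ₗ[R] Q} {g : Q →ₗ[R] M}
      (_ : Function.Exact f g) (_ : Function.Surjective g),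
      (∀ i : ℕ, 1 ≤ i → i ≤ d → ExtVanishes Rᵐᵒᵖ (TransposeOf f) R i) ↔
        HasDominantCosyzygy R d M := by
  induction d with
  | zero =>
    intros
    exact ⟨fun _ => trivial, fun _ i hi hi' => absurd hi (by omega)⟩
  | succ d ih =>
    intro P Q M _ _ _ _ _ _ _ _ _ _ f g hfg hg
    -- A left approximation `M → F` induces `Q → F` with the property required above.
    have hdual : ∀ {F : Type u} [AddCommGroup F] [Module R F] (j : M →ₗ[R] F)
        (_ : ∀ φ : M →ₗ[R] R, ∃ ψ : F →ₗ[R] R, ψ ∘ₗ j = φ) (φ : Q →ₗ[R] R), φ ∘ₗ f = 0 →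
        ∃ ψ : F →ₗ[R] R, ψ ∘ₗ (j ∘ₗ g) = φ := by
      intro F _ _ j hj φ hφ
      have hle : LinearMap.ker g ≤ LinearMap.ker φ := by
        rw [hfg.linearMap_ker_eq]
        rintro _ ⟨x, rfl⟩
        exact LinearMap.congr_fun hφ x
      obtain ⟨ψ, hψ⟩ := hj ((LinearMap.ker g).liftQ φ hle ∘ₗ
        (g.quotKerEquivOfSurjective hg).symm.toLinearMap)
      refine ⟨ψ, ?_⟩
      rw [← LinearMap.comp_assoc, hψ]
      ext y
      have : (g.quotKerEquivOfSurjective hg).symm (g y) = Submodule.Quotient.mk y := by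
        rw [LinearEquiv.symm_apply_eq]; rfl
      simp [this]
    have hzero : ∀ {F : Type u} [AddCommGroup F] [Module R F] (j : M →ₗ[R] F),
        (j ∘ₗ g) ∘ₗ f = 0 := by
      intro F _ _ j
      rw [LinearMap.comp_assoc, hfg.linearMap_comp_eq_zero, LinearMap.comp_zero]
    have hrange : ∀ {F : Type u} [AddCommGroup F] [Module R F] (j : M →ₗ[R] F),
        LinearMap.range (j ∘ₗ g) = LinearMap.range j := by
      intro F _ _ j
      rw [LinearMap.range_comp, LinearMap.range_eq_top.2 hg, Submodule.map_top]
    constructor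
    · intro h
      have : Module.Finite R M := Module.Finite.of_surjective g hg
      obtain ⟨J, _, j, hj⟩ := hR.exists_free_approximation M
      have h1 := (extVanishes_transpose_one_iff (hzero j) (hdual j hj)).1 (h 1 le_rfl (by omega))
      refine ⟨J → R, (J → R) ⧸ LinearMap.range j, _, _, _, _, j, (LinearMap.range j).mkQ,
        inferInstance, inferInstance, ?_, LinearMap.exact_map_mkQ_range j,
        Submodule.mkQ_surjective _, hj, ?_⟩
      · rw [injective_iff_map_eq_zero]
        intro x hx
        obtain ⟨y, rfl⟩ := hg x
        obtain ⟨z, rfl⟩ := (h1 y).1 hx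
        exact hfg.apply_apply_eq_zero z
      · refine (ih (f := j ∘ₗ g) ?_ (Submodule.mkQ_surjective _)).1 fun i hi hid => ?_
        · rw [LinearMap.exact_iff, hrange, Submodule.ker_mkQ]
        · obtain ⟨i, rfl⟩ : ∃ k, i = k + 1 := ⟨i - 1, by omega⟩
          exact (extVanishes_transpose_succ_iff (hzero j) (hdual j hj) i).1
            (h (i + 2) (by omega) (by omega))
    · rintro ⟨F, C, _, _, _, _, j, q, _, _, h3, h4, h5, h6, h7⟩ i hi hid
      have hex : Function.Exact (j ∘ₗ g) q := by
        rw [LinearMap.exact_iff, hrange, ← LinearMap.exact_iff]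
        exact h4
      obtain _ | _ | i := i
      · omega
      · refine (extVanishes_transpose_one_iff (hzero j) (hdual j h6)).2 fun y => ?_
        rw [LinearMap.comp_apply, map_eq_zero_iff j h3]
        exact hfg y
      · exact (extVanishes_transpose_succ_iff (hzero j) (hdual j h6) i).2
          ((ih hex h5).2 h7 (i + 1) (by omega) (by omega))

theorem isTorsionfree_iff (hR : IsNoetherAlgebra R) {d : ℕ} {M : Type u} [AddCommGroup M]
    [Module R M] [Module.Finite R M] : IsTorsionfree d R M ↔ HasDominantCosyzygy R d M := by
  constructor
  · rintro ⟨P, Q, _, _, _, _, f, g, _, _, _, _, hfg, hg, h⟩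
    exact (extVanishes_transpose_iff hR hfg hg).1 h
  · intro h
    obtain ⟨n, g, hg⟩ := Module.Finite.exists_fin' R M
    have := hR.finite_ker g
    obtain ⟨m, f, hf⟩ := Module.Finite.exists_fin' R (LinearMap.ker g)
    have hex : Function.Exact ((LinearMap.ker g).subtype ∘ₗ f) g := by
      rw [LinearMap.exact_iff, LinearMap.range_comp, LinearMap.range_eq_top.2 hf,
        Submodule.map_subtype_top]
    exact ⟨Fin m → R, Fin n → R, _, _, _, _, (LinearMap.ker g).subtype ∘ₗ f, g,
      inferInstance, inferInstance, inferInstance, inferInstance, hex, hg,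
      (extVanishes_transpose_iff hR hex hg).2 h⟩

/-- If `0 → L → F₀ → ⋯ → F_{c-1}` is a dominant cosyzygy sequence, then `Ext^i(X, R) = 0` for
`i < c` implies `Ext^i(X, L) = 0` for `i < c`. -/
theorem HasDominantCosyzygy.extVanishes {X : Type u} [AddCommGroup X] [Module R X] {c : ℕ}
    (hX : ∀ i < c, ExtVanishes R X R i) :
    ∀ {L : Type u} [AddCommGroup L] [Module R L], HasDominantCosyzygy R c L →
      ∀ i < c, ExtVanishes R X L i := by
  induction c with
  | zero => intro L _ _ _ i hi; omega
  | succ c ih =>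
    rintro L _ _ ⟨F, C, _, _, _, _, j, q, _, _, h3, h4, h5, -, h7⟩ i hi
    obtain _ | i := i
    · rw [extVanishes_zero_iff]
      intro f
      have h0 : ExtVanishes R X F 0 := (hX 0 (by omega)).of_finite_projective
      have := extVanishes_zero_iff.1 h0 (j ∘ₗ f)
      exact LinearMap.ext fun x => h3 (by simpa using LinearMap.congr_fun this x)
    · exact ExtVanishes.left_succ h3 h4 h5 (ih (fun i hi => hX i (by omega)) h7 i (by omega))
        (hX (i + 1) hi).of_finite_projective

theorem IsSyzygy.finite (hR : IsNoetherAlgebra R) {c : ℕ} {K : Type u} [AddCommGroup K]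
    [Module R K] : ∀ {X : Type u} [AddCommGroup X] [Module R X] [Module.Finite R X],
      IsSyzygy R c X K → Module.Finite R K := by
  induction c with
  | zero =>
    rintro X _ _ _ ⟨e⟩
    exact Module.Finite.equiv e.symm
  | succ c ih =>
    rintro X _ _ _ ⟨P, _, _, p, _, _, _, h⟩
    have := hR.finite_ker p
    exact ih h

/-- If `Ext^i(X, R) = 0` for `1 ≤ i ≤ c`, then taking `c`-th syzygies of `X` adds `c` steps to a
dominant cosyzygy sequence. -/
theorem IsSyzygy.hasDominantCosyzygy {c : ℕ} {K : Type u} [AddCommGroup K] [Module R K] :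
    ∀ {X : Type u} [AddCommGroup X] [Module R X] (_ : IsSyzygy R c X K)
      (_ : ∀ i < c, ExtVanishes R X R (i + 1)) {j : ℕ} (_ : HasDominantCosyzygy R j X),
      HasDominantCosyzygy R (j + c) K := by
  induction c with
  | zero =>
    rintro X _ _ ⟨e⟩ _ j h
    exact h.of_equiv e
  | succ c ih =>
    rintro X _ _ ⟨P, _, _, p, _, _, hp, h⟩ hX j hj
    have hi := Submodule.subtype_injective (LinearMap.ker p)
    have he := LinearMap.exact_subtype_ker_map p
    have h1 : HasDominantCosyzygy R (j + 1) (LinearMap.ker p) :=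
      ⟨P, X, _, _, _, _, (LinearMap.ker p).subtype, p, inferInstance, inferInstance, hi, he, hp,
        exists_extension_of_extVanishes hi he hp (hX 0 (by omega)), hj⟩
    have h2 := ih h (fun i hic => ExtVanishes.source_left hi he hp (ExtVanishes.of_projective i)
      (hX (i + 1) (by omega))) h1
    rwa [show j + (c + 1) = j + 1 + c by omega]

end Torsionfree


/-! ### The extension class of a syzygy -/

section SyzygyClass

variable {R : Type u} [Ring R]

/-- A linear map that factors through a finitely generated projective module. -/
def FactorsProjective {K L : Type u} [AddCommGroup K] [Module R K] [AddCommGroup L] [Module R L]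
    (f : K →ₗ[R] L) : Prop :=
  ∃ (G : Type u) (_ : AddCommGroup G) (_ : Module R G) (u : K →ₗ[R] G) (v : G →ₗ[R] L),
    Module.Finite R G ∧ Module.Projective R G ∧ v ∘ₗ u = f

theorem FactorsProjective.add {K L : Type u} [AddCommGroup K] [Module R K] [AddCommGroup L]
    [Module R L] {f f' : K →ₗ[R] L} (h : FactorsProjective f) (h' : FactorsProjective f') :
    FactorsProjective (f + f') := by
  obtain ⟨G, _, _, u, v, _, _, rfl⟩ := h
  obtain ⟨G', _, _, u', v', _, _, rfl⟩ := h'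
  exact ⟨G × G', _, _, u.prod u', v.coprod v', inferInstance, inferInstance, by ext; simp⟩

/-- A class `δ ∈ Ext^c(X, K)` with the properties of the class of an exact sequence
`0 → K → P_{c-1} → ⋯ → P₀ → X → 0`. -/
structure IsSyzygyClass {X K : Type u} [AddCommGroup X] [Module R X] [AddCommGroup K] [Module R K]
    {c : ℕ} (δ : Ext (ModuleCat.of R X) (ModuleCat.of R K) c) : Prop where
  factors : ∀ {L : Type u} [AddCommGroup L] [Module R L] (f : K →ₗ[R] L),
    δ.comp (Ext.mk₀ (ModuleCat.ofHom f)) (add_zero c) = 0 → FactorsProjective f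
  exists_comp_eq : ∀ {L : Type u} [AddCommGroup L] [Module R L]
    (x : Ext (ModuleCat.of R X) (ModuleCat.of R L) c),
    ∃ f : K →ₗ[R] L, δ.comp (Ext.mk₀ (ModuleCat.ofHom f)) (add_zero c) = x
  bijective : ∀ {Y : Type u} [AddCommGroup Y] [Module R Y] {j k : ℕ} (hk : j + c = k),
    (∀ i, j ≤ i → i ≤ k → ExtVanishes R Y R i) →
    Function.Bijective fun x : Ext (ModuleCat.of R Y) (ModuleCat.of R X) j => x.comp δ hk

theorem IsSyzygy.exists_class {c : ℕ} {K : Type u} [AddCommGroup K] [Module R K] :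
    ∀ {X : Type u} [AddCommGroup X] [Module R X], IsSyzygy R c X K →
      ∃ δ : Ext (ModuleCat.of R X) (ModuleCat.of R K) c, IsSyzygyClass δ := by
  induction c with
  | zero =>
    rintro X _ _ ⟨e⟩
    have h1 : ModuleCat.ofHom e.symm.toLinearMap ≫ ModuleCat.ofHom e.toLinearMap = 𝟙 _ := by
      ext; simp
    have h2 : ModuleCat.ofHom e.toLinearMap ≫ ModuleCat.ofHom e.symm.toLinearMap = 𝟙 _ := by
      ext; simp
    refine ⟨Ext.mk₀ (ModuleCat.ofHom e.symm.toLinearMap), ?_, ?_, ?_⟩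
    · intro L _ _ f hf
      rw [Ext.mk₀_comp_mk₀, Ext.mk₀_eq_zero_iff] at hf
      have : f = 0 := LinearMap.ext fun x => by
        simpa using LinearMap.congr_fun (congrArg ModuleCat.Hom.hom hf) (e x)
      subst this
      exact ⟨PUnit, _, _, 0, 0, inferInstance, inferInstance, rfl⟩
    · intro L _ _ x
      obtain ⟨g, rfl⟩ := (Ext.mk₀_bijective _ _).2 x
      refine ⟨g.hom ∘ₗ e.toLinearMap, ?_⟩
      rw [Ext.mk₀_comp_mk₀]
      congr 1
      ext
      simp
    · intro Y _ _ j k hk _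
      obtain rfl : j = k := hk
      refine Function.bijective_iff_has_inverse.2
        ⟨fun y => y.comp (Ext.mk₀ (ModuleCat.ofHom e.toLinearMap)) (add_zero j), fun x => ?_,
          fun x => ?_⟩
      · simp [h1]
      · simp [h2]
  | succ c ih =>
    rintro X _ _ ⟨P, _, _, p, _, _, hp, h⟩
    obtain ⟨δ, hδ⟩ := ih h
    have hS := shortExact_moduleCat (Submodule.subtype_injective (LinearMap.ker p))
      (LinearMap.exact_subtype_ker_map p) hp
    refine ⟨hS.extClass.comp δ (add_comm 1 c), ?_, ?_, ?_⟩
    · intro L _ _ f hf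
      rw [Ext.comp_assoc_of_third_deg_zero] at hf
      obtain ⟨x, hx⟩ := Ext.contravariant_sequence_exact₁ hS _ _ _ hf
      obtain _ | c := c
      · -- The map `x : P → L` restricts to `f` up to a map killed by `δ`.
        obtain ⟨φ, rfl⟩ := (Ext.mk₀_bijective _ _).2 x
        obtain ⟨t, ht⟩ := hδ.exists_comp_eq (Ext.mk₀ (ModuleCat.ofHom (LinearMap.ker p).subtype))
        have h1 : FactorsProjective (f - φ.hom ∘ₗ t) := by
          refine hδ.factors _ ?_
          have : ModuleCat.ofHom (f - φ.hom ∘ₗ t) =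
              ModuleCat.ofHom f + -(ModuleCat.ofHom t ≫ φ) := by
            ext; simp [sub_eq_add_neg]
          rw [this, Ext.mk₀_add, Ext.comp_add, Ext.mk₀_neg, Ext.comp_neg, ← hx,
            ← Ext.mk₀_comp_mk₀, ← Ext.comp_assoc_of_third_deg_zero, ht, add_neg_cancel]
        have h2 : FactorsProjective (φ.hom ∘ₗ t) :=
          ⟨P, _, _, t, φ.hom, inferInstance, inferInstance, rfl⟩
        simpa using h1.add h2
      · refine hδ.factors f ?_
        rw [← hx, (ExtVanishes.of_projective (S := R) (X := P) (Y := L) c).elim x 0, Ext.comp_zero]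
    · intro L _ _ x
      obtain ⟨y, rfl⟩ := Ext.contravariant_sequence_exact₃ hS _ x
        ((ExtVanishes.of_projective (S := R) (X := P) (Y := L) c).elim _ _) (add_comm 1 c)
      obtain ⟨f, rfl⟩ := hδ.exists_comp_eq y
      exact ⟨f, by rw [Ext.comp_assoc_of_third_deg_zero]⟩
    · intro Y _ _ j k hk hY
      have h1 : Function.Bijective fun x : Ext (ModuleCat.of R Y) (ModuleCat.of R X) j =>
          x.comp hS.extClass (rfl : j + 1 = j + 1) := by
        constructor
        · refine (injective_iff_map_eq_zero (hS.extClass.postcomp (ModuleCat.of R Y) rfl)).2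
            fun x hx => ?_
          obtain ⟨y, rfl⟩ := Ext.covariant_sequence_exact₃ _ hS x rfl hx
          rw [(hY j le_rfl (by omega)).of_finite_projective.elim y 0, Ext.zero_comp]
        · intro y
          exact Ext.covariant_sequence_exact₁ _ hS y
            ((hY (j + 1) (by omega) (by omega)).of_finite_projective.elim _ _) rfl
      convert (hδ.bijective (Y := Y) (j := j + 1) (k := k) (by omega)
        fun i hi hik => hY i (by omega) hik).comp h1 using 1
      ext x
      exact (Ext.comp_assoc _ _ _ _ _ (by omega)).symm

end SyzygyClass


/-! ### Maps that factor through a generator -/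

section Factor

variable {R : Type u} [Ring R] (M : Type u) [AddCommGroup M] [Module R M]

/-- The maps `K → L` that factor through a finite direct sum of copies of `M`: the subgroup of
`Hom_R(K, L)` generated by the composites `K → M → L`. -/
def factorSubgroup (K L : Type u) [AddCommGroup K] [Module R K] [AddCommGroup L] [Module R L] :
    AddSubgroup (K →ₗ[R] L) :=
  AddSubgroup.closure {f | ∃ (u : K →ₗ[R] M) (v : M →ₗ[R] L), v ∘ₗ u = f}

variable {M} {K L K' L' : Type u} [AddCommGroup K] [Module R K] [AddCommGroup L] [Module R L]
  [AddCommGroup K'] [Module R K'] [AddCommGroup L'] [Module R L']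

theorem comp_mem_factorSubgroup (v : M →ₗ[R] L) (u : K →ₗ[R] M) :
    v ∘ₗ u ∈ factorSubgroup M K L :=
  AddSubgroup.subset_closure ⟨u, v, rfl⟩

theorem comp_mem_factorSubgroup_of_left {f : K →ₗ[R] L} (hf : f ∈ factorSubgroup M K L)
    (a : L →ₗ[R] L') : a ∘ₗ f ∈ factorSubgroup M K L' := by
  induction hf using AddSubgroup.closure_induction with
  | mem f hf =>
    obtain ⟨u, v, rfl⟩ := hf
    exact comp_mem_factorSubgroup (a ∘ₗ v) u
  | zero => rw [LinearMap.comp_zero]; exact zero_mem _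
  | add f g _ _ hf hg => rw [LinearMap.comp_add]; exact add_mem hf hg
  | neg f _ hf => rw [LinearMap.comp_neg]; exact neg_mem hf

theorem comp_mem_factorSubgroup_of_right {f : K →ₗ[R] L} (hf : f ∈ factorSubgroup M K L)
    (a : K' →ₗ[R] K) : f ∘ₗ a ∈ factorSubgroup M K' L := by
  induction hf using AddSubgroup.closure_induction with
  | mem f hf =>
    obtain ⟨u, v, rfl⟩ := hf
    exact comp_mem_factorSubgroup v (u ∘ₗ a)
  | zero => rw [LinearMap.zero_comp]; exact zero_mem _
  | add f g _ _ hf hg => rw [LinearMap.add_comp]; exact add_mem hf hg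
  | neg f _ hf => rw [LinearMap.neg_comp]; exact neg_mem hf

theorem comp_pi_mem_factorSubgroup {J : Type*} [Fintype J] (a : (J → M) →ₗ[R] L)
    (w : K →ₗ[R] (J → M)) : a ∘ₗ w ∈ factorSubgroup M K L := by
  classical
  have : a ∘ₗ w = ∑ j, (a ∘ₗ LinearMap.single R (fun _ : J => M) j) ∘ₗ (LinearMap.proj j ∘ₗ w) := by
    ext x
    simp [LinearMap.sum_apply, ← map_sum, Finset.univ_sum_single]
  rw [this]
  exact sum_mem fun j _ => comp_mem_factorSubgroup _ _

/-- If all maps `M → L` lift along `a`, then so do the maps to `L` that factor through sums of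
copies of `M`. -/
theorem exists_lift_of_mem_factorSubgroup {L₁ : Type u} [AddCommGroup L₁] [Module R L₁]
    {a : L₁ →ₗ[R] L} (ha : ∀ φ : M →ₗ[R] L, ∃ v : M →ₗ[R] L₁, a ∘ₗ v = φ) {f : K →ₗ[R] L}
    (hf : f ∈ factorSubgroup M K L) : ∃ g : K →ₗ[R] L₁, a ∘ₗ g = f := by
  induction hf using AddSubgroup.closure_induction with
  | mem f hf =>
    obtain ⟨u, v, rfl⟩ := hf
    obtain ⟨w, rfl⟩ := ha v
    exact ⟨w ∘ₗ u, rfl⟩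
  | zero => exact ⟨0, LinearMap.comp_zero _⟩
  | add f g _ _ hf hg =>
    obtain ⟨f', rfl⟩ := hf
    obtain ⟨g', rfl⟩ := hg
    exact ⟨f' + g', LinearMap.comp_add _ _ _⟩
  | neg f _ hf =>
    obtain ⟨f', rfl⟩ := hf
    exact ⟨-f', LinearMap.comp_neg _ _⟩

variable (hM : IsGenerator R M)
include hM

theorem IsGenerator.id_mem_factorSubgroup : (LinearMap.id : R →ₗ[R] R) ∈ factorSubgroup M R R := by
  obtain ⟨n, i, p, hpi⟩ := hM
  rw [← hpi]
  exact comp_pi_mem_factorSubgroup p i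

theorem IsGenerator.mem_factorSubgroup {f : K →ₗ[R] L} (hf : FactorsProjective f) :
    f ∈ factorSubgroup M K L := by
  obtain ⟨G, _, _, u, v, _, _, rfl⟩ := hf
  refine comp_mem_factorSubgroup_of_right ?_ u
  obtain ⟨n, x, φ, hx⟩ := exists_dual_basis (R := R) G
  have : v = ∑ i, (LinearMap.toSpanSingleton R L (v (x i)) ∘ₗ LinearMap.id) ∘ₗ φ i := by
    ext y
    conv_lhs => rw [← hx y]
    simp [LinearMap.sum_apply]
  rw [this]
  exact sum_mem fun i _ => comp_mem_factorSubgroup_of_right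
    (comp_mem_factorSubgroup_of_left hM.id_mem_factorSubgroup _) _

/-- A map out of `L` that vanishes on all images of `M` is zero. -/
theorem IsGenerator.eq_zero {w : L →ₗ[R] L'} (hw : ∀ t : M →ₗ[R] L, w ∘ₗ t = 0) : w = 0 := by
  have key : ∀ f ∈ factorSubgroup M R L, w ∘ₗ f = 0 := by
    intro f hf
    induction hf using AddSubgroup.closure_induction with
    | mem f hf =>
      obtain ⟨u, v, rfl⟩ := hf
      rw [← LinearMap.comp_assoc, hw, LinearMap.zero_comp]
    | zero => exact LinearMap.comp_zero _
    | add f g _ _ hf hg => rw [LinearMap.comp_add, hf, hg, add_zero]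
    | neg f _ hf => rw [LinearMap.comp_neg, hf, neg_zero]
  refine LinearMap.ext fun x => ?_
  have := LinearMap.congr_fun (key _ (comp_mem_factorSubgroup_of_left hM.id_mem_factorSubgroup
    (LinearMap.toSpanSingleton R L x))) 1
  simpa using this

theorem IsGenerator.surjective_of_exists_lift {L₁ : Type u} [AddCommGroup L₁] [Module R L₁]
    {a : L₁ →ₗ[R] L} (ha : ∀ φ : M →ₗ[R] L, ∃ v : M →ₗ[R] L₁, a ∘ₗ v = φ) :
    Function.Surjective a := fun x => by
  obtain ⟨g, hg⟩ := exists_lift_of_mem_factorSubgroup ha (comp_mem_factorSubgroup_of_left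
    hM.id_mem_factorSubgroup (LinearMap.toSpanSingleton R L x))
  exact ⟨g 1, by simpa using LinearMap.congr_fun hg 1⟩

end Factor

/-! ### Modules of homomorphisms over an endomorphism ring -/

section HomModule

variable (R : Type u) [Ring R] (M K W L : Type u) [AddCommGroup M] [Module R M] [AddCommGroup K]
  [Module R K] [AddCommGroup W] [Module R W] [AddCommGroup L] [Module R L]

/-- `Hom_R(W, L)` as a module over the endomorphism ring of `W`, acting by precomposition. -/
def HomModule : Type u := W →ₗ[R] L

instance : AddCommGroup (HomModule R W L) := inferInstanceAs (AddCommGroup (W →ₗ[R] L))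

variable {R W L}

/-- A homomorphism, as an element of the module over the endomorphism ring. -/
def HomModule.mk : (W →ₗ[R] L) ≃+ HomModule R W L := AddEquiv.refl _

instance : Module (EndRing R W) (HomModule R W L) where
  smul b f := HomModule.mk (HomModule.mk.symm f ∘ₗ b.unop)
  one_smul _ := rfl
  mul_smul _ _ _ := rfl
  smul_zero b := LinearMap.zero_comp b.unop
  smul_add b f g := LinearMap.add_comp b.unop g f
  add_smul b c f := LinearMap.comp_add b.unop c.unop f
  zero_smul f := LinearMap.comp_zero f

/-- Postcomposition with a linear map. -/
def HomModule.postcomp {L' : Type u} [AddCommGroup L'] [Module R L'] (a : L →ₗ[R] L') :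
    HomModule R W L →ₗ[EndRing R W] HomModule R W L' where
  toFun f := HomModule.mk (a ∘ₗ HomModule.mk.symm f)
  map_add' f g := LinearMap.comp_add (HomModule.mk.symm f) (HomModule.mk.symm g) a
  map_smul' _ _ := rfl

variable (R W) in
/-- `Hom_R(W, W)` is the regular module. -/
def HomModule.selfEquiv : EndRing R W ≃ₗ[EndRing R W] HomModule R W W where
  toFun b := HomModule.mk b.unop
  map_add' _ _ := rfl
  map_smul' _ _ := rfl
  invFun f := MulOpposite.op (HomModule.mk.symm f)
  left_inv _ := rfl
  right_inv _ := rfl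

variable (R) in
/-- The inclusion of the endomorphism ring of `M` into that of `M × K`, as the corner at the
idempotent projecting to `M`. -/
def cornerHom : EndRing R M →ₙ+* EndRing R (M × K) where
  toFun a := MulOpposite.op (LinearMap.inl R M K ∘ₗ a.unop ∘ₗ LinearMap.fst R M K)
  map_mul' a b := by
    apply MulOpposite.unop_injective
    ext x <;> simp
  map_zero' := by
    apply MulOpposite.unop_injective
    ext x <;> simp
  map_add' a b := by
    apply MulOpposite.unop_injective
    ext x <;> simp

variable {M K}

theorem unop_cornerHom (a : EndRing R M) : (cornerHom R M K a).unop =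
    LinearMap.inl R M K ∘ₗ a.unop ∘ₗ LinearMap.fst R M K := rfl

variable (R M K) in
theorem cornerHom_injective : Function.Injective (cornerHom R M K) := by
  intro a b hab
  apply MulOpposite.unop_injective
  ext x
  have := congrArg (fun c => (c.unop (x, 0)).1) hab
  simpa [unop_cornerHom] using this

theorem exists_cornerHom_eq (b : EndRing R (M × K)) :
    ∃ a, cornerHom R M K a = cornerHom R M K 1 * b * cornerHom R M K 1 :=
  ⟨MulOpposite.op (LinearMap.fst R M K ∘ₗ b.unop ∘ₗ LinearMap.inl R M K), rfl⟩

/-- In `N = Hom(M ⊕ K, L)`, the submodule `BeN` consists of the maps that factor through sums of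
copies of `M`. -/
theorem mem_cornerSpan_iff (f : M × K →ₗ[R] L) :
    HomModule.mk f ∈ cornerSpan (cornerHom R M K) (HomModule R (M × K) L) ↔
      f ∈ factorSubgroup M (M × K) L := by
  let S : Submodule (EndRing R (M × K)) (HomModule R (M × K) L) :=
    { carrier := {x | HomModule.mk.symm x ∈ factorSubgroup M (M × K) L}
      add_mem' := fun hx hy => (factorSubgroup M (M × K) L).add_mem hx hy
      zero_mem' := zero_mem (factorSubgroup M (M × K) L)
      smul_mem' := fun b _ hx => comp_mem_factorSubgroup_of_right hx b.unop }
  constructor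
  · intro h
    refine (Submodule.span_le (p := S)).2 (fun x hx => ?_) h
    have h1 : HomModule.mk.symm x =
        (HomModule.mk.symm x ∘ₗ LinearMap.inl R M K) ∘ₗ LinearMap.fst R M K :=
      (congrArg HomModule.mk.symm hx).symm
    change HomModule.mk.symm x ∈ factorSubgroup M (M × K) L
    rw [h1]
    exact comp_mem_factorSubgroup _ _
  · intro h
    induction h using AddSubgroup.closure_induction with
    | mem f hf =>
      obtain ⟨u, v, rfl⟩ := hf
      have h1 : cornerHom R M K 1 • HomModule.mk (v ∘ₗ LinearMap.fst R M K) =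
        HomModule.mk (v ∘ₗ LinearMap.fst R M K) := rfl
      have h2 : HomModule.mk (v ∘ₗ u) = MulOpposite.op (LinearMap.inl R M K ∘ₗ u) •
        HomModule.mk (v ∘ₗ LinearMap.fst R M K) := rfl
      rw [h2]
      exact Submodule.smul_mem _ _ (Submodule.subset_span h1)
    | zero => rw [map_zero]; exact zero_mem _
    | add f g _ _ hf hg => rw [map_add]; exact add_mem hf hg
    | neg f _ hf => rw [map_neg]; exact neg_mem hf

section Generator

variable (hM : IsGenerator R M)
include hM

theorem IsGenerator.eq_zero_of_cornerHom {f : M × K →ₗ[R] L}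
    (h : ∀ b : EndRing R (M × K), cornerHom R M K 1 • b • HomModule.mk f = 0) : f = 0 := by
  refine hM.eq_zero fun t => LinearMap.ext fun x => ?_
  exact LinearMap.congr_fun (h (MulOpposite.op (t ∘ₗ LinearMap.fst R M K))) (x, 0)

theorem isCornerProjective_homModule : IsCornerProjective (cornerHom R M K)
    (HomModule R (M × K) M) where
  projective :=
    have : Module.Projective (EndRing R (M × K)) (HomModule R (M × K) (M × K)) :=
      Module.Projective.of_equiv' (HomModule.selfEquiv R (M × K))
    Module.Projective.of_split (HomModule.postcomp (LinearMap.inl R M K))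
      (HomModule.postcomp (LinearMap.fst R M K)) (LinearMap.ext fun _ => rfl)
  corner := by
    let g : EndRing R M →ₗ[EndRing R M] Corner (cornerHom R M K) (HomModule R (M × K) M) :=
      { toFun := fun a => Corner.mk (HomModule.mk (a.unop ∘ₗ LinearMap.fst R M K)) rfl
        map_add' := fun _ _ => rfl
        map_smul' := fun _ _ => rfl }
    refine Module.Projective.of_equiv' (LinearEquiv.ofBijective g ⟨fun a b hab => ?_, fun y => ?_⟩)
    · apply MulOpposite.unop_injective
      refine LinearMap.ext fun x => ?_
      exact LinearMap.congr_fun (congrArg (fun z => HomModule.mk.symm (Corner.val _ z)) hab) (x, 0)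
    · exact ⟨MulOpposite.op (HomModule.mk.symm (Corner.val _ y) ∘ₗ LinearMap.inl R M K),
        Corner.val_injective y.smul_val⟩
  eq_zero _ h := hM.eq_zero_of_cornerHom h

theorem isCornerProjective_homModule_pi (J : Type u) [Fintype J] :
    IsCornerProjective (cornerHom R M K) (HomModule R (M × K) (J → M)) := by
  refine ((isCornerProjective_homModule (K := K) hM).finsupp J).of_equiv
    (Finsupp.linearEquivFunOnFinite (EndRing R (M × K)) (HomModule R (M × K) M) J ≪≫ₗ ?_)
  exact
    { toFun := fun f => HomModule.mk (LinearMap.pi fun j => HomModule.mk.symm (f j))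
      map_add' := fun _ _ => rfl
      map_smul' := fun _ _ => rfl
      invFun := fun f j => HomModule.mk (LinearMap.proj j ∘ₗ HomModule.mk.symm f)
      left_inv := fun _ => rfl
      right_inv := fun _ => rfl }

end Generator

end HomModule


/-! ### The endomorphism ring of `M ⊕ Ω^c X` -/

section Main

variable {R : Type u} [Ring R] {M X K : Type u} [AddCommGroup M] [Module R M]
  [AddCommGroup X] [Module R X] [AddCommGroup K] [Module R K] {c : ℕ}
  {δ : Ext (ModuleCat.of R X) (ModuleCat.of R K) c}

variable (M δ) in
/-- The image in `Ext^c(X, M ⊕ K)` of a class in `Ext^c(X, K)`. -/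
def prodClass : Ext (ModuleCat.of R X) (ModuleCat.of R (M × K)) c :=
  δ.comp (Ext.mk₀ (ModuleCat.ofHom (LinearMap.inr R M K))) (add_zero c)

theorem prodClass_comp {L : Type u} [AddCommGroup L] [Module R L] (f : M × K →ₗ[R] L) :
    (prodClass M δ).comp (Ext.mk₀ (ModuleCat.ofHom f)) (add_zero c) =
      δ.comp (Ext.mk₀ (ModuleCat.ofHom (f ∘ₗ LinearMap.inr R M K))) (add_zero c) := by
  rw [prodClass, Ext.comp_assoc_of_third_deg_zero, Ext.mk₀_comp_mk₀]
  rfl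

/-- The maps `M ⊕ K → L` killed by the class in `Ext^c(X, M ⊕ K)` are those factoring through
sums of copies of `M`. -/
theorem prodClass_comp_eq_zero_iff (hδ : IsSyzygyClass δ) (hM : IsGenerator R M)
    (hXM : ExtVanishes R X M c) {L : Type u} [AddCommGroup L] [Module R L]
    (f : M × K →ₗ[R] L) :
    (prodClass M δ).comp (Ext.mk₀ (ModuleCat.ofHom f)) (add_zero c) = 0 ↔
      f ∈ factorSubgroup M (M × K) L := by
  constructor
  · intro h
    rw [prodClass_comp] at h
    have h1 := comp_mem_factorSubgroup_of_right (hM.mem_factorSubgroup (hδ.factors _ h))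
      (LinearMap.snd R M K)
    have h2 := comp_mem_factorSubgroup (f ∘ₗ LinearMap.inl R M K) (LinearMap.fst R M K)
    have : f = (f ∘ₗ LinearMap.inl R M K) ∘ₗ LinearMap.fst R M K +
        (f ∘ₗ LinearMap.inr R M K) ∘ₗ LinearMap.snd R M K :=
      LinearMap.ext fun x => by simp [← map_add]
    rw [this]
    exact add_mem h2 h1
  · intro h
    induction h using AddSubgroup.closure_induction with
    | mem f hf =>
      obtain ⟨u, v, rfl⟩ := hf
      rw [ModuleCat.ofHom_comp, ← Ext.mk₀_comp_mk₀, ← Ext.comp_assoc_of_third_deg_zero,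
        hXM.elim ((prodClass M δ).comp (Ext.mk₀ (ModuleCat.ofHom u)) (add_zero c)) 0,
        Ext.zero_comp]
    | zero =>
      have : ModuleCat.ofHom (0 : M × K →ₗ[R] L) = 0 := rfl
      rw [this, Ext.mk₀_zero, Ext.comp_zero]
    | add f g _ _ hf hg =>
      have : ModuleCat.ofHom (f + g) = ModuleCat.ofHom f + ModuleCat.ofHom g := rfl
      rw [this, Ext.mk₀_add, Ext.comp_add, hf, hg, add_zero]
    | neg f _ hf =>
      have : ModuleCat.ofHom (-f) = -ModuleCat.ofHom f := rfl
      rw [this, Ext.mk₀_neg, Ext.comp_neg, hf, neg_zero]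

theorem exists_prodClass_comp_eq (hδ : IsSyzygyClass δ) {L : Type u} [AddCommGroup L] [Module R L]
    (x : Ext (ModuleCat.of R X) (ModuleCat.of R L) c) :
    ∃ f : M × K →ₗ[R] L, (prodClass M δ).comp (Ext.mk₀ (ModuleCat.ofHom f)) (add_zero c) = x := by
  obtain ⟨f, rfl⟩ := hδ.exists_comp_eq x
  refine ⟨f ∘ₗ LinearMap.snd R M K, ?_⟩
  rw [prodClass_comp]
  rfl

theorem bijective_comp_prodClass (hδ : IsSyzygyClass δ) (hXR : ∀ i ≤ c, ExtVanishes R X R i)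
    (hXM : ExtVanishes R X M c) : Function.Bijective fun g : Module.End R X =>
      (Ext.mk₀ (ModuleCat.ofHom g)).comp (prodClass M δ) (zero_add c) := by
  have h1 : Function.Bijective fun x : Ext (ModuleCat.of R X) (ModuleCat.of R K) c =>
      x.comp (Ext.mk₀ (ModuleCat.ofHom (LinearMap.inr R M K))) (add_zero c) := by
    have hinr : ModuleCat.ofHom (LinearMap.inr R M K) ≫ ModuleCat.ofHom (LinearMap.snd R M K) =
        𝟙 _ := rfl
    have hid : 𝟙 (ModuleCat.of R (M × K)) =
        ModuleCat.ofHom (LinearMap.fst R M K) ≫ ModuleCat.ofHom (LinearMap.inl R M K) +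
        ModuleCat.ofHom (LinearMap.snd R M K) ≫ ModuleCat.ofHom (LinearMap.inr R M K) := by
      ext x <;> simp
    refine Function.bijective_iff_has_inverse.2
      ⟨fun y => y.comp (Ext.mk₀ (ModuleCat.ofHom (LinearMap.snd R M K))) (add_zero c),
        fun x => ?_, fun y => ?_⟩
    · simp [hinr]
    · conv_rhs => rw [← y.comp_mk₀_id, hid, Ext.mk₀_add, Ext.comp_add, ← Ext.mk₀_comp_mk₀,
        ← Ext.mk₀_comp_mk₀, ← Ext.comp_assoc_of_third_deg_zero, ← Ext.comp_assoc_of_third_deg_zero,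
        hXM.elim (y.comp (Ext.mk₀ (ModuleCat.ofHom (LinearMap.fst R M K))) (add_zero c)) 0,
        Ext.zero_comp, zero_add]
  have h2 := hδ.bijective (Y := X) (zero_add c) fun i _ hi => hXR i hi
  have h3 : Function.Bijective fun g : Module.End R X =>
      Ext.mk₀ (ModuleCat.ofHom (X := X) (Y := X) g) :=
    (Ext.mk₀_bijective _ _).comp (ModuleCat.homEquiv (M := ModuleCat.of R X)
      (N := ModuleCat.of R X)).symm.bijective
  convert h1.comp (h2.comp h3) using 1
  ext g
  exact (Ext.comp_assoc_of_third_deg_zero _ _ _ _).symm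

/-- If `g ↦ g δ'` is a bijection from `End(X)` to `Ext^c(X, W)`, there is a ring homomorphism
`End(W) → End(X)` sending `b` to the unique `g` with `g δ' = δ' b`. -/
theorem exists_ringHom_of_bijective {W : Type u} [AddCommGroup W] [Module R W]
    {δ' : Ext (ModuleCat.of R X) (ModuleCat.of R W) c}
    (h : Function.Bijective fun g : Module.End R X =>
      (Ext.mk₀ (ModuleCat.ofHom g)).comp δ' (zero_add c)) :
    ∃ ρ : EndRing R W →+* EndRing R X, ∀ b,
      (Ext.mk₀ (ModuleCat.ofHom (ρ b).unop)).comp δ' (zero_add c) =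
        δ'.comp (Ext.mk₀ (ModuleCat.ofHom b.unop)) (add_zero c) := by
  have hex : ∀ b : EndRing R W, ∃ g : Module.End R X,
      (Ext.mk₀ (ModuleCat.ofHom g)).comp δ' (zero_add c) =
        δ'.comp (Ext.mk₀ (ModuleCat.ofHom b.unop)) (add_zero c) := fun b => h.2 _
  choose r hr using hex
  have hr' : ∀ b g, (Ext.mk₀ (ModuleCat.ofHom g)).comp δ' (zero_add c) =
      δ'.comp (Ext.mk₀ (ModuleCat.ofHom b.unop)) (add_zero c) → r b = g := fun b g hg =>
    h.1 ((hr b).trans hg.symm)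
  refine ⟨{ toFun := fun b => MulOpposite.op (r b)
            map_one' := ?_
            map_mul' := fun b b' => ?_
            map_zero' := ?_
            map_add' := fun b b' => ?_ }, hr⟩
  · refine congrArg MulOpposite.op (hr' _ _ ?_)
    exact (δ'.mk₀_id_comp).trans δ'.comp_mk₀_id.symm
  · refine congrArg MulOpposite.op (hr' _ (r b' * r b) ?_)
    have e1 : ModuleCat.ofHom (r b' * r b) =
      ModuleCat.ofHom (r b) ≫ ModuleCat.ofHom (r b') := rfl
    have e2 : ModuleCat.ofHom (b * b').unop =
      ModuleCat.ofHom b.unop ≫ ModuleCat.ofHom b'.unop := rfl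
    rw [e1, e2, ← Ext.mk₀_comp_mk₀, ← Ext.mk₀_comp_mk₀, Ext.comp_assoc_of_second_deg_zero, hr,
      ← Ext.comp_assoc_of_third_deg_zero, hr, Ext.comp_assoc_of_third_deg_zero]
  · refine congrArg MulOpposite.op (hr' _ 0 ?_)
    have e1 : ModuleCat.ofHom (0 : X →ₗ[R] X) = 0 := rfl
    have e2 : ModuleCat.ofHom (MulOpposite.unop (0 : EndRing R W)) = 0 := rfl
    rw [e1, e2, Ext.mk₀_zero, Ext.mk₀_zero, Ext.zero_comp, Ext.comp_zero]
  · refine congrArg MulOpposite.op (hr' _ (r b + r b') ?_)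
    have e1 : ModuleCat.ofHom (r b + r b') = ModuleCat.ofHom (r b) + ModuleCat.ofHom (r b') := rfl
    have e2 : ModuleCat.ofHom (b + b').unop =
      ModuleCat.ofHom b.unop + ModuleCat.ofHom b'.unop := rfl
    rw [e1, e2, Ext.mk₀_add, Ext.mk₀_add, Ext.add_comp, Ext.comp_add, hr, hr]

/-- Let `Ext^i(X, L) = 0` for `i < c`. The maps from `M ⊕ K` to `L` that factor through sums of
copies of `M` form a module of projective dimension at most that of `Hom(M, L)`: the kernel `L₁`
of an approximation of `L` has `Ext^i(X, L₁) = 0` for `i ≤ c`, so that all maps `M ⊕ K → L₁`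
factor through sums of copies of `M`. -/
theorem pd_cornerSpan_homModule_le (hR : IsNoetherAlgebra R) [Module.Finite R M]
    (hδ : IsSyzygyClass δ) (hM : IsGenerator R M) (hXM : ∀ i ≤ c, ExtVanishes R X M i) {k : ℕ} :
    ∀ (L : Type u) [AddCommGroup L] [Module R L] [Module.Finite R L],
      (∀ i < c, ExtVanishes R X L i) →
      PdLE (EndRing R M) (Corner (cornerHom R M K) (HomModule R (M × K) L)) k →
      PdLE (EndRing R (M × K)) (cornerSpan (cornerHom R M K) (HomModule R (M × K) L)) k := by
  -- The sequence `0 → Hom(W, L₁) → Hom(W, M^J) → BeN → 0`, where `W = M ⊕ K`, `N = Hom(W, L)` and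
  -- `L₁` is the kernel of an approximation `M^J → L`.
  have main : ∀ (L : Type u) [AddCommGroup L] [Module R L] [Module.Finite R L],
      (∀ i < c, ExtVanishes R X L i) →
      ∃ (J : Type u) (_ : Fintype J) (L₁ : Type u) (_ : AddCommGroup L₁) (_ : Module R L₁)
        (_ : Module.Finite R L₁)
        (f : HomModule R (M × K) L₁ →ₗ[EndRing R (M × K)] HomModule R (M × K) (J → M))
        (p : HomModule R (M × K) (J → M) →ₗ[EndRing R (M × K)]
          cornerSpan (cornerHom R M K) (HomModule R (M × K) L)),
        (∀ i < c, ExtVanishes R X L₁ i) ∧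
        cornerSpan (cornerHom R M K) (HomModule R (M × K) L₁) = ⊤ ∧
        Function.Injective f ∧ Function.Exact f p ∧ Function.Surjective p := by
    intro L _ _ _ hL
    obtain ⟨J, _, a, ha⟩ := hR.exists_approximation M L
    have hsurj : Function.Surjective a := hM.surjective_of_exists_lift ha
    have hinj := Submodule.subtype_injective (LinearMap.ker a)
    have hL₁ : ∀ i ≤ c, ExtVanishes R X (LinearMap.ker a) i := by
      intro i hi
      obtain _ | i := i
      · rw [extVanishes_zero_iff]
        intro f
        have := extVanishes_zero_iff.1 ((hXM 0 hi).pi J) ((LinearMap.ker a).subtype ∘ₗ f)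
        exact LinearMap.ext fun x => hinj (LinearMap.congr_fun this x)
      · exact ExtVanishes.left_succ hinj (LinearMap.exact_subtype_ker_map a) hsurj
          (hL i (by omega)) ((hXM (i + 1) hi).pi J)
    refine ⟨J, inferInstance, LinearMap.ker a, _, _, hR.finite_ker a,
      HomModule.postcomp (LinearMap.ker a).subtype,
      (HomModule.postcomp a).codRestrict _ fun w =>
        (mem_cornerSpan_iff _).2 (comp_pi_mem_factorSubgroup a (HomModule.mk.symm w)),
      fun i hi => hL₁ i hi.le, ?_, ?_, ?_, ?_⟩
    · refine eq_top_iff.2 fun w _ => (mem_cornerSpan_iff (HomModule.mk.symm w)).2 ?_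
      exact (prodClass_comp_eq_zero_iff hδ hM (hXM c le_rfl) _).1 ((hL₁ c le_rfl).elim _ _)
    · intro w w' hw
      refine LinearMap.ext fun x => hinj ?_
      exact LinearMap.congr_fun (congrArg HomModule.mk.symm hw) x
    · intro w
      constructor
      · intro hw
        have hw' : a ∘ₗ HomModule.mk.symm w = 0 := congrArg Subtype.val hw
        exact ⟨HomModule.mk ((HomModule.mk.symm w).codRestrict _ fun x =>
          LinearMap.congr_fun hw' x), rfl⟩
      · rintro ⟨w, rfl⟩
        exact Subtype.ext (LinearMap.ext fun x => (HomModule.mk.symm w x).2)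
    · rintro ⟨w, hw⟩
      obtain ⟨g, hg⟩ := exists_lift_of_mem_factorSubgroup ha
        ((mem_cornerSpan_iff (HomModule.mk.symm w)).1 hw)
      exact ⟨HomModule.mk g, Subtype.ext hg⟩
  induction k with
  | zero =>
    intro L _ _ _ hL h
    obtain ⟨J, _, L₁, _, _, _, f, p, -, -, -, -, hp⟩ := main L hL
    have hF := isCornerProjective_homModule_pi (K := K) hM J
    have := hF.projective
    have := pdLE_zero_iff.1 (h.of_equiv (cornerCornerSpanEquiv _ _).symm)
    have := projective_of_projective_corner _ exists_cornerHom_eq hF.eq_zero p hp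
      cornerSpan_cornerSpan
    exact PdLE.of_projective _
  | succ k ih =>
    intro L _ _ _ hL h
    obtain ⟨J, _, L₁, _, _, _, f, p, hL₁, htop, hf, hfp, hp⟩ := main L hL
    have hF := isCornerProjective_homModule_pi (K := K) hM J
    have := hF.projective
    have := hF.corner
    have h₁ : PdLE (EndRing R M) (Corner (cornerHom R M K) (HomModule R (M × K) L₁)) k :=
      PdLE.left (Corner.map_injective hf) (Corner.map_exact hfp) (Corner.map_surjective hp)
        (PdLE.of_projective k) (h.of_equiv (cornerCornerSpanEquiv _ _).symm)
    exact PdLE.right hf hfp hp ((ih L₁ hL₁ h₁).of_equiv (LinearEquiv.ofTop _ htop))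
      (PdLE.of_projective _)

/-- The bound on the global dimension of `End(M ⊕ K)`. -/
theorem gldim_endRing_prod_le (hR : IsNoetherAlgebra R) [Module.Finite R M] [Module.Finite R K]
    (hδ : IsSyzygyClass δ) (hM : IsGenerator R M) (hXR : ∀ i ≤ c, ExtVanishes R X R i)
    (hXM : ∀ i ≤ c, ExtVanishes R X M i) (hXK : ∀ i < c, ExtVanishes R X K i) {n m : ℕ}
    (hn : gldim (EndRing R M) ≤ n) (hm : gldim (EndRing R X) ≤ m) :
    gldim (EndRing R (M × K)) ≤ (2 * n + m + 1 : ℕ) := by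
  -- The surjection `ρ : End(M ⊕ K) → End(X)` and its kernel.
  obtain ⟨ρ, hρ⟩ := exists_ringHom_of_bijective
    (bijective_comp_prodClass hδ hXR (hXM c le_rfl))
  have hbij := bijective_comp_prodClass hδ hXR (hXM c le_rfl)
  have hker : ∀ b, ρ b = 0 ↔ b.unop ∈ factorSubgroup M (M × K) (M × K) := by
    intro b
    rw [← prodClass_comp_eq_zero_iff hδ hM (hXM c le_rfl), ← hρ b]
    have h0 : (Ext.mk₀ (ModuleCat.ofHom (0 : Module.End R X))).comp (prodClass M δ)
        (zero_add c) = 0 := by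
      have e1 : ModuleCat.ofHom (0 : X →ₗ[R] X) = 0 := rfl
      exact (congrArg (fun z => (Ext.mk₀ z).comp (prodClass M δ) (zero_add c)) e1).trans
        (by rw [Ext.mk₀_zero, Ext.zero_comp])
    rw [← h0, hbij.1.eq_iff, MulOpposite.unop_eq_zero_iff]
  have hsurj : Function.Surjective ρ := by
    intro g
    obtain ⟨b, hb⟩ := exists_prodClass_comp_eq (M := M) hδ
      ((Ext.mk₀ (ModuleCat.ofHom g.unop)).comp (prodClass M δ) (zero_add c))
    refine ⟨MulOpposite.op b, MulOpposite.unop_injective (hbij.1 ?_)⟩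
    exact (hρ _).trans hb
  -- The projective dimension of `End(X)` as an `End(M ⊕ K)`-module.
  have hT : HasProjectiveDimensionLE
      ((ModuleCat.restrictScalars ρ).obj (ModuleCat.of (EndRing R X) (EndRing R X))) (n + 1) := by
    let p : HomModule R (M × K) (M × K) →ₗ[EndRing R (M × K)]
        (ModuleCat.restrictScalars ρ).obj (ModuleCat.of (EndRing R X) (EndRing R X)) :=
      { toFun := fun f => ρ (MulOpposite.op (HomModule.mk.symm f))
        map_add' := fun f g => ρ.map_add _ _
        map_smul' := fun b f => ρ.map_mul b (MulOpposite.op (HomModule.mk.symm f)) }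
    have hp : Function.Surjective p := fun g => by
      obtain ⟨b, rfl⟩ := hsurj g
      exact ⟨HomModule.mk b.unop, rfl⟩
    have hW : ∀ i < c, ExtVanishes R X (M × K) i := fun i hi =>
      ExtVanishes.middle (f := LinearMap.inl R M K) (g := LinearMap.snd R M K)
        LinearMap.inl_injective Function.Exact.inl_snd LinearMap.snd_surjective (hXM i hi.le)
        (hXK i hi)
    have h1 := pd_cornerSpan_homModule_le hR hδ hM hXM (M × K) hW (gldim_le_iff.1 hn _)
    have hex : Function.Exact
        (cornerSpan (cornerHom R M K) (HomModule R (M × K) (M × K))).subtype p := by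
      rw [LinearMap.exact_iff, Submodule.range_subtype]
      ext f
      exact (hker _).trans (mem_cornerSpan_iff (HomModule.mk.symm f)).symm
    have : Module.Projective (EndRing R (M × K)) (HomModule R (M × K) (M × K)) :=
      Module.Projective.of_equiv' (HomModule.selfEquiv R (M × K))
    exact PdLE.right (Submodule.subtype_injective _) hex hp h1 (PdLE.of_projective _)
  -- Modules with zero corner are killed by the kernel of `ρ`.
  have ht : ∀ (N : Type u) [AddCommGroup N] [Module (EndRing R (M × K)) N],
      (∀ x : N, cornerHom R M K 1 • x = x → x = 0) → PdLE (EndRing R (M × K)) N (n + 1 + m) := by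
    intro N _ _ hN
    have key : ∀ f ∈ factorSubgroup M (M × K) (M × K), ∀ x : N,
        (MulOpposite.op f : EndRing R (M × K)) • x = 0 := by
      intro f hf
      induction hf using AddSubgroup.closure_induction with
      | mem f hf =>
        obtain ⟨u, v, rfl⟩ := hf
        intro x
        have e1 : (MulOpposite.op (v ∘ₗ u) : EndRing R (M × K)) =
          MulOpposite.op (LinearMap.inl R M K ∘ₗ u) *
            MulOpposite.op (v ∘ₗ LinearMap.fst R M K) := rfl
        have e2 : cornerHom R M K 1 * MulOpposite.op (v ∘ₗ LinearMap.fst R M K) =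
          MulOpposite.op (v ∘ₗ LinearMap.fst R M K) := rfl
        rw [e1, mul_smul, hN (MulOpposite.op (v ∘ₗ LinearMap.fst R M K) • x), smul_zero]
        rw [← mul_smul, e2]
      | zero => intro x; rw [MulOpposite.op_zero, zero_smul]
      | add f g _ _ hf hg => intro x; rw [MulOpposite.op_add, add_smul, hf, hg, add_zero]
      | neg f _ hf => intro x; rw [MulOpposite.op_neg, neg_smul, hf, neg_zero]
    exact pd_le_of_surjective hsurj hT hm fun b hb => key b.unop ((hker b).1 hb)
  refine gldim_le_iff.2 fun N _ _ => ?_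
  have := pd_le_of_corner (cornerHom_injective R M K) exists_cornerHom_eq
    (fun x _ h => MulOpposite.unop_injective (hM.eq_zero_of_cornerHom fun b =>
      congrArg (HomModule.selfEquiv R (M × K)) ((mul_assoc _ _ _).symm.trans (h b)))) ht
    (gldim_le_iff.1 hn (Corner (cornerHom R M K) N))
  exact this.mono (by omega)

end Main

end

theorem theorem1p1 (R : Type u) [Ring R] (hR : IsNoetherAlgebra R)
    (M X : Type u) [AddCommGroup M] [Module R M] [Module.Finite R M]
    [AddCommGroup X] [Module R X] [Module.Finite R X]
    (d : ℕ) (hMd : IsTorsionfree d R M) (hMgen : IsGenerator R M) (hMncr : GivesNCR R M)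
    (hX : gldim (EndRing R X) ≠ ⊤)
    (c : ℕ) (hc : (c : ℕ∞) < min (d : ℕ∞) (moduleGrade R X))
    (K : Type u) [AddCommGroup K] [Module R K] (hK : IsSyzygy R c X K) :
    (IsTorsionfree c R (M × K) ∧ IsGenerator R (M × K)) ∧
    gldim (EndRing R (M × K)) ≤ 2 * gldim (EndRing R M) + gldim (EndRing R X) + 1 ∧
    GivesNCR R (M × K) := by
  have hcd : c < d := by exact_mod_cast (lt_min_iff.1 hc).1
  have hXR : ∀ i ≤ c, ExtVanishes R X R i := fun i hi =>
    extVanishes_of_lt_moduleGrade (lt_of_le_of_lt (by exact_mod_cast hi) (lt_min_iff.1 hc).2)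
  have hfinK : Module.Finite R K := hK.finite hR
  have hMtf := (isTorsionfree_iff hR).1 hMd
  have hKtf : HasDominantCosyzygy R c K := by
    have := hK.hasDominantCosyzygy (fun i hi => hXR (i + 1) hi) (j := 0) trivial
    rwa [zero_add] at this
  -- As `c < d`, the module `M` has a dominant cosyzygy sequence of length `c + 1`.
  have hXM : ∀ i ≤ c, ExtVanishes R X M i := fun i hi =>
    (hMtf.mono (c := c + 1) hcd).extVanishes (fun i hi => hXR i (by omega)) i (by omega)
  have hXK : ∀ i < c, ExtVanishes R X K i := hKtf.extVanishes fun i hi => hXR i hi.le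
  obtain ⟨δ, hδ⟩ := hK.exists_class
  obtain ⟨n, hn⟩ := ENat.ne_top_iff_exists.1 hMncr.gldim_ne_top
  obtain ⟨m, hm⟩ := ENat.ne_top_iff_exists.1 hX
  have hbound := gldim_endRing_prod_le hR hδ hMgen hXR hXM hXK hn.ge hm.ge
  refine ⟨⟨(isTorsionfree_iff hR).2 ((hMtf.mono hcd.le).prod hKtf), ?_⟩, ?_, inferInstance, ?_, ?_⟩
  · obtain ⟨r, i, p, hpi⟩ := hMgen
    refine ⟨r, LinearMap.pi fun j => LinearMap.inl R M K ∘ₗ LinearMap.proj j ∘ₗ i,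
      p ∘ₗ LinearMap.pi fun j => LinearMap.fst R M K ∘ₗ LinearMap.proj j, ?_⟩
    rw [← hpi]
    rfl
  · rw [← hn, ← hm]
    exact_mod_cast hbound
  · have := hMncr.faithful
    refine ⟨fun {a b} h => FaithfulSMul.eq_of_smul_eq_smul (α := M) fun x => ?_⟩
    exact congrArg Prod.fst (h (x, 0))
  · exact ne_top_of_le_ne_top (ENat.natCast_ne_top _) hbound
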